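/- Let $N\ge 1$ be an integer, $Y_1(N)(\mathbf C)=\Gamma_1(N)\backslash\mathfrak H$ and $X_1(N)(\mathbf C)=\Gamma_1(N)\backslash(\mathfrak H\cup\mathbf P^1(\mathbf Q))$. Let $E_N$ be the set of $(u,v)\in(\mathbf Z/N\mathbf Z)^2$ with $\gcd(u,v,N)=1$, on which $\mathrm{SL}_2(\mathbf Z)$ acts on the right, and for $x\in E_N$ let $g_x\in \mathrm{SL}_2(\mathbf Z)$ be any matrix whose bottom row is congruent to $x$ modulo $N$. Put $\rho=e^{\pi i/3}$, $\tau=\begin{pmatrix}0&-1\\1&-1\end{pmatrix}$, and for $\alpha,\beta\in\mathfrak H\cup\mathbf P^1(\mathbf Q)$ let $\{\alpha,\beta\}$ be the relative homology class of the image of the geodesic from $\alpha$ to $\beta$. For $x\in E_N$ let $\xi(x)=\{g_x0,g_x\infty\}\in H_1(X_1(N)(\mathbf C),\{\mathrm{cusps}\},\mathbf Z)$. Let $f\in S_2(\Gamma_1(N))$ and, for $x=(u,v)\in E_N$, set $x^c=(-u,v)$ and $$\xi_f(x)=-i\int_{g_x0}^{g_x\infty}f(z)\,dz,\qquad \xi_f^+(x)=\tfrac12\bigl(\xi_f(x)+\xi_f(x^c)\bigr).$$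 Let $P\subset Y_1(N)(\mathbf C)$ be the set of images of the points $\gamma\rho,\gamma\rho^2$, $\gamma\in\mathrm{SL}_2(\mathbf Z)$, and define in $H_1(Y_1(N)(\mathbf C),P,\mathbf Z)\otimes\mathbf C$ $$\gamma_f=\sum_{x\in E_N}\xi_f(x)\{g_x\rho,g_x\rho^2\},\qquad \gamma_f^-=\tfrac12(\gamma_f-c_*\gamma_f),$$ where $c$ is the complex conjugation on $Y_1(N)(\mathbf C)$ induced by $z\mapsto-\overline z$. Then $\gamma_f$ and $\gamma_f^-$ are closed (their boundaries in $H_0(P,\mathbf Z)\otimes\mathbf C$ vanish), so that each of them comes from a unique class in $H_1(Y_1(N)(\mathbf C),\mathbf Z)\otimes\mathbf C$, and the images of these classes in $H_1(X_1(N)(\mathbf C),\mathbf Z)\otimes\mathbf C$, which is regarded as a subspace of $H_1(X_1(N)(\mathbf C),\{\mathrm{cusps}\},\mathbf Z)\otimes\mathbf C$, are $$\gamma_f=-\frac13\sum_{x\in E_N}\bigl(\xi_f(x)+2\xi_f(x\tau)\bigr)\,\xi(x),\qquad \gamma_f^-=-\frac13\sum_{x\in E_N}\bigl(\xi_f^+(x)+2\xi_f^+(x\tau)\bigr)\,\xi(x).$$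 -/

import Mathlib

open scoped MatrixGroups TensorProduct UpperHalfPlane

noncomputable section

namespace ModSym

/-! ### Singular chains and relative singular homology with integer coefficients -/

section Homology

/-- Singular `n`-chains of `X` with integer coefficients: the free abelian group on the
continuous maps from the standard `n`-simplex to `X`. -/
abbrev Chain (X : Type*) [TopologicalSpace X] (n : ℕ) : Type _ :=
  C(stdSimplex ℝ (Fin (n + 1)), X) →₀ ℤ

/-- The inclusion of the `i`-th face (opposite to the `i`-th vertex). -/
def face {n : ℕ} (i : Fin (n + 2)) :
    C(stdSimplex ℝ (Fin (n + 1)), stdSimplex ℝ (Fin (n + 2))) :=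
  ⟨stdSimplex.map i.succAbove, stdSimplex.continuous_map _⟩

variable {X Y Z : Type*} [TopologicalSpace X] [TopologicalSpace Y] [TopologicalSpace Z]

/-- The boundary operator `∂ σ = ∑ᵢ (-1)ⁱ σ ∘ δᵢ`. -/
def bd (X : Type*) [TopologicalSpace X] (n : ℕ) : Chain X (n + 1) →ₗ[ℤ] Chain X n :=
  Finsupp.linearCombination ℤ fun σ =>
    ∑ i : Fin (n + 2), Finsupp.single (σ.comp (face i)) ((-1) ^ (i : ℕ))

/-- The chains of `X` that lie in the subset `A`. -/
def chainsIn (A : Set X) (n : ℕ) : Submodule ℤ (Chain X n) :=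
  Finsupp.supported ℤ ℤ {σ | ∀ s, σ s ∈ A}

/-- Relative `1`-cycles of the pair `(X, A)`. -/
def relCycles (A : Set X) : Submodule ℤ (Chain X 1) := (chainsIn A 0).comap (bd X 0)

/-- Relative `1`-boundaries of the pair `(X, A)`. -/
def relBoundaries (A : Set X) : Submodule ℤ (Chain X 1) :=
  LinearMap.range (bd X 1) ⊔ chainsIn A 1

/-- The relative singular homology group `H₁(X, A; ℤ)`. For `A = ∅` this is `H₁(X; ℤ)`. -/
abbrev H1 (X : Type*) [TopologicalSpace X] (A : Set X) : Type _ :=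
  relCycles A ⧸ (relBoundaries A).submoduleOf (relCycles A)

/-- The singular homology group `H₀(A; ℤ)` of a subspace `A` of `X`. -/
abbrev H0 {X : Type*} [TopologicalSpace X] (A : Set X) : Type _ :=
  chainsIn A 0 ⧸ ((chainsIn A 1).map (bd X 0)).submoduleOf (chainsIn A 0)

theorem bd_single {n : ℕ} (σ : C(stdSimplex ℝ (Fin (n + 2)), X)) (a : ℤ) :
    bd X n (Finsupp.single σ a) =
      a • ∑ i : Fin (n + 2), Finsupp.single (σ.comp (face i)) ((-1) ^ (i : ℕ)) := by
  simp [bd]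

theorem face_comp {n : ℕ} (i : Fin (n + 3)) (j : Fin (n + 2)) (i' : Fin (n + 3)) (j' : Fin (n + 2))
    (h : i.succAbove ∘ j.succAbove = i'.succAbove ∘ j'.succAbove) :
    (face i).comp (face j) = (face i').comp (face j') := by
  ext1 s
  simp only [face, ContinuousMap.comp_apply, ContinuousMap.coe_mk, stdSimplex.map_comp_apply, h]

theorem bd_bd (c : Chain X 2) : bd X 0 (bd X 1 c) = 0 := by
  induction c using Finsupp.induction_linear with
  | zero => simp
  | add a b ha hb => simp [ha, hb]
  | single σ a =>
    have h1 : (face (n := 1) 0).comp (face 0) = (face 1).comp (face 0) :=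
      face_comp _ _ _ _ (by decide)
    have h2 : (face (n := 1) 0).comp (face 1) = (face 2).comp (face 0) :=
      face_comp _ _ _ _ (by decide)
    have h3 : (face (n := 1) 1).comp (face 1) = (face 2).comp (face 1) :=
      face_comp _ _ _ _ (by decide)
    rw [bd_single, map_smul, map_sum]
    simp only [bd_single, ContinuousMap.comp_assoc, Fin.sum_univ_succ]
    simp [h1, h2, h3]
    abel

/-- Functoriality of chains. -/
def chainMap (f : C(X, Y)) (n : ℕ) : Chain X n →ₗ[ℤ] Chain Y n :=
  Finsupp.lmapDomain ℤ ℤ fun σ => f.comp σ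

theorem chainMap_bd (f : C(X, Y)) (n : ℕ) (c : Chain X (n + 1)) :
    bd Y n (chainMap f (n + 1) c) = chainMap f n (bd X n c) := by
  induction c using Finsupp.induction_linear with
  | zero => simp
  | add a b ha hb => simp [ha, hb]
  | single σ a =>
    simp only [bd_single, chainMap, Finsupp.lmapDomain_apply, Finsupp.mapDomain_single, map_smul,
      map_sum, ContinuousMap.comp_assoc]

theorem chainMap_mem {A : Set X} {B : Set Y} (f : C(X, Y)) (hf : Set.MapsTo f A B) (n : ℕ)
    {c : Chain X n} (hc : c ∈ chainsIn A n) : chainMap f n c ∈ chainsIn B n := by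
  classical
  intro τ hτ
  obtain ⟨σ, hσ, rfl⟩ := Finset.mem_image.1 (Finsupp.mapDomain_support hτ)
  exact fun s => hf (hc hσ s)

/-- The map on relative cycles. -/
def relCyclesMap {A : Set X} {B : Set Y} (f : C(X, Y)) (hf : Set.MapsTo f A B) :
    relCycles A →ₗ[ℤ] relCycles B :=
  (chainMap f 1).restrict fun c hc => by
    change bd Y 0 (chainMap f 1 c) ∈ chainsIn B 0
    rw [chainMap_bd]
    exact chainMap_mem f hf 0 hc

/-- The map `f_* : H₁(X, A; ℤ) → H₁(Y, B; ℤ)` induced by a map of pairs. -/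
def H1.map {A : Set X} {B : Set Y} (f : C(X, Y)) (hf : Set.MapsTo f A B) :
    H1 X A →ₗ[ℤ] H1 Y B :=
  Submodule.mapQ _ _ (relCyclesMap f hf) fun c hc => by
    obtain ⟨u, ⟨d, hd⟩, v, hv, huv⟩ := Submodule.mem_sup.1 (show (c : Chain X 1) ∈ _ from hc)
    refine Submodule.mem_sup.2 ⟨chainMap f 1 u, ⟨chainMap f 2 d, ?_⟩, chainMap f 1 v,
      chainMap_mem f hf 1 hv, ?_⟩
    · rw [chainMap_bd, hd]
    · rw [← map_add, huv]; rfl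

/-- The canonical map `H₁(X; ℤ) → H₁(X, A; ℤ)`. -/
def H1.toRel (A : Set X) : H1 X ∅ →ₗ[ℤ] H1 X A :=
  H1.map (ContinuousMap.id X) (Set.mapsTo_empty _ _)

/-- The map `H₁(X; ℤ) → H₁(Y; ℤ)` induced by a continuous map. -/
def H1.push (f : C(X, Y)) : H1 X ∅ →ₗ[ℤ] H1 Y ∅ := H1.map f (Set.mapsTo_empty _ _)

/-- The connecting map `∂ : H₁(X, A; ℤ) → H₀(A; ℤ)` of the pair `(X, A)`. -/
def H1.boundary (A : Set X) : H1 X A →ₗ[ℤ] H0 A :=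
  Submodule.mapQ _ _ ((bd X 0).restrict fun _ hc => hc) fun c hc => by
    obtain ⟨u, ⟨d, hd⟩, v, hv, huv⟩ := Submodule.mem_sup.1 (show (c : Chain X 1) ∈ _ from hc)
    refine ⟨v, hv, ?_⟩
    change bd X 0 v = bd X 0 (c : Chain X 1)
    have hu : bd X 0 u = 0 := by rw [← hd]; exact bd_bd d
    rw [← huv, map_add]
    exact (zero_add (bd X 0 v)).symm.trans (congrArg (· + bd X 0 v) hu.symm)

/-- The singular `1`-simplex given by a path: the vertex `0` goes to the source of the path and
the vertex `1` to its target. -/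
def pathSimplex {a b : X} (p : Path a b) : C(stdSimplex ℝ (Fin 2), X) where
  toFun s := p ⟨s 1, stdSimplex.zero_le s 1, stdSimplex.le_one s 1⟩
  continuous_toFun := p.continuous.comp <| Continuous.subtype_mk
    ((continuous_apply (1 : Fin 2)).comp continuous_subtype_val) _

theorem pathSimplex_mem {A : Set X} {a b : X} (p : Path a b) (ha : a ∈ A) (hb : b ∈ A) :
    Finsupp.single (pathSimplex p) 1 ∈ relCycles A := by
  have h0 : ∀ s : stdSimplex ℝ (Fin 1), (face (n := 0) 0 s) = stdSimplex.vertex 1 := by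
    intro s
    rw [Subsingleton.elim s (stdSimplex.vertex 0)]
    simp [face]
  have h1 : ∀ s : stdSimplex ℝ (Fin 1), (face (n := 0) 1 s) = stdSimplex.vertex 0 := by
    intro s
    rw [Subsingleton.elim s (stdSimplex.vertex 0)]
    simp [face]
  change bd X 0 _ ∈ chainsIn A 0
  rw [bd_single, one_smul, Fin.sum_univ_two]
  refine add_mem (Finsupp.single_mem_supported ℤ _ ?_) (Finsupp.single_mem_supported ℤ _ ?_)
  · intro s
    have : pathSimplex p (stdSimplex.vertex 1) = b := by simp [pathSimplex]
    simpa [h0, this] using hb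
  · intro s
    have : pathSimplex p (stdSimplex.vertex 0) = a := by simp [pathSimplex]
    simpa [h1, this] using ha

/-- The class in `H₁(X, A; ℤ)` of a path whose end points lie in `A`. -/
def pathClass (A : Set X) {a b : X} (p : Path a b) (ha : a ∈ A) (hb : b ∈ A) : H1 X A :=
  Submodule.Quotient.mk ⟨Finsupp.single (pathSimplex p) 1, pathSimplex_mem p ha hb⟩

end Homology

/-! ### The extended upper half-plane -/

/-- The extended upper half-plane `ℍ ∪ ℙ¹(ℚ)`. -/
inductive HStar : Type
  | pt (z : ℍ) : HStar
  | cusp (s : OnePoint ℚ) : HStar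

namespace HStar

/-- `SL₂(ℤ)` acts on both parts by homographies. -/
instance : MulAction SL(2, ℤ) HStar where
  smul g w := match w with
    | pt z => pt (g • z)
    | cusp s => cusp (Matrix.SpecialLinearGroup.mapGL ℚ g • s)
  one_smul w := by
    rcases w with z | s
    · exact congrArg pt (one_smul _ z)
    · exact congrArg cusp (by rw [map_one, one_smul])
  mul_smul g h w := by
    rcases w with z | s
    · exact congrArg pt (mul_smul g h z)
    · exact congrArg cusp (by rw [map_mul, mul_smul])

theorem smul_pt (g : SL(2, ℤ)) (z : ℍ) : g • pt z = pt (g • z) := rfl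

theorem smul_cusp (g : SL(2, ℤ)) (s : OnePoint ℚ) :
    g • cusp s = cusp (Matrix.SpecialLinearGroup.mapGL ℚ g • s) := rfl

/-- The usual topology: a set is open if its trace on `ℍ` is open and if, together with a cusp
`g ∞`, it contains a horoball `g {Im z > B}` at that cusp. -/
instance : TopologicalSpace HStar where
  IsOpen U := IsOpen (pt ⁻¹' U) ∧
    ∀ g : SL(2, ℤ), g • cusp OnePoint.infty ∈ U →
      ∃ B : ℝ, ∀ z : ℍ, B < z.im → g • pt z ∈ U
  isOpen_univ := ⟨isOpen_univ, fun _ _ => ⟨0, fun _ _ => trivial⟩⟩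
  isOpen_inter U V hU hV := by
    refine ⟨hU.1.inter hV.1, fun g hg => ?_⟩
    obtain ⟨B, hB⟩ := hU.2 g hg.1
    obtain ⟨C, hC⟩ := hV.2 g hg.2
    exact ⟨max B C, fun z hz => ⟨hB z ((le_max_left _ _).trans_lt hz),
      hC z ((le_max_right _ _).trans_lt hz)⟩⟩
  isOpen_sUnion S hS := by
    refine ⟨?_, fun g ⟨U, hU, hg⟩ => ?_⟩
    · rw [Set.preimage_sUnion]
      exact isOpen_biUnion fun U hU => (hS U hU).1
    · obtain ⟨B, hB⟩ := (hS U hU).2 g hg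
      exact ⟨B, fun z hz => ⟨U, hU, hB z hz⟩⟩

theorem isOpen_def {U : Set HStar} : IsOpen U ↔ IsOpen (pt ⁻¹' U) ∧
    ∀ g : SL(2, ℤ), g • cusp OnePoint.infty ∈ U →
      ∃ B : ℝ, ∀ z : ℍ, B < z.im → g • pt z ∈ U := Iff.rfl

theorem continuous_pt : Continuous pt := ⟨fun _ hU => hU.1⟩

theorem continuous_smul_upper (g : SL(2, ℤ)) : Continuous fun z : ℍ => g • z :=
  continuous_const_smul (Matrix.SpecialLinearGroup.mapGL ℝ g)

theorem continuous_smul_star (g : SL(2, ℤ)) : Continuous fun w : HStar => g • w := by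
  refine ⟨fun U hU => ⟨hU.1.preimage (continuous_smul_upper g), fun h hh => ?_⟩⟩
  obtain ⟨B, hB⟩ := hU.2 (g * h) (by rw [mul_smul]; exact hh)
  exact ⟨B, fun z hz => by
    have := hB z hz
    rwa [mul_smul] at this⟩

end HStar

open HStar

/-! ### The modular curves `Y₁(N)(ℂ)` and `X₁(N)(ℂ)` -/

/-- `Y₁(N)(ℂ) = Γ₁(N) \ ℍ`, with the quotient topology. -/
abbrev Y1 (N : ℕ) : Type := MulAction.orbitRel.Quotient (CongruenceSubgroup.Gamma1 N) ℍ

/-- `X₁(N)(ℂ) = Γ₁(N) \ (ℍ ∪ ℙ¹(ℚ))`, with the quotient topology. -/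
abbrev X1 (N : ℕ) : Type := MulAction.orbitRel.Quotient (CongruenceSubgroup.Gamma1 N) HStar

/-- The projection `ℍ → Y₁(N)(ℂ)`. -/
def projY (N : ℕ) : C(ℍ, Y1 N) := ⟨fun z => Quotient.mk _ z, continuous_quotient_mk'⟩

/-- The projection `ℍ ∪ ℙ¹(ℚ) → X₁(N)(ℂ)`. -/
def projX (N : ℕ) : C(HStar, X1 N) := ⟨fun w => Quotient.mk _ w, continuous_quotient_mk'⟩

/-- The inclusion `Y₁(N)(ℂ) → X₁(N)(ℂ)`. -/
def inclYX (N : ℕ) : C(Y1 N, X1 N) where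
  toFun := Quotient.lift (fun z : ℍ => projX N (pt z)) fun _ _ ⟨γ, hγ⟩ =>
    Quotient.sound ⟨γ, congrArg pt hγ⟩
  continuous_toFun := ((projX N).continuous.comp continuous_pt).quotient_lift _

/-- The set of cusps of `X₁(N)(ℂ)`. -/
def cusps (N : ℕ) : Set (X1 N) := Set.range fun s => projX N (cusp s)

/-! ### The points `ρ`, `ρ²` and the two geodesics -/

theorem arc_im_pos (t : unitInterval) : 0 < (Complex.exp (Real.pi / 3 * (1 + (t : ℝ)) * Complex.I)).im := by
  have h : (Real.pi / 3 * (1 + (t : ℝ)) * Complex.I : ℂ)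
      = ((Real.pi / 3 * (1 + (t : ℝ)) : ℝ) : ℂ) * Complex.I := by push_cast; ring
  rw [h, Complex.exp_ofReal_mul_I_im]
  have h0 := t.2.1
  have h1 := t.2.2
  have hp := Real.pi_pos
  apply Real.sin_pos_of_pos_of_lt_pi <;> nlinarith

theorem rho_im_pos : 0 < (Complex.exp (Real.pi * Complex.I / 3)).im := by
  have h := arc_im_pos 0
  have e : (Real.pi / 3 * (1 + ((0 : unitInterval) : ℝ)) * Complex.I : ℂ) = Real.pi * Complex.I / 3 := by
    simp; ring
  rwa [e] at h

theorem rhoSq_im_pos : 0 < (Complex.exp (Real.pi * Complex.I / 3) ^ 2).im := by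
  have h := arc_im_pos 1
  have e : (Real.pi / 3 * (1 + ((1 : unitInterval) : ℝ)) * Complex.I : ℂ)
      = ((2 : ℕ) : ℂ) * (Real.pi * Complex.I / 3) := by
    simp; ring
  rwa [e, Complex.exp_nat_mul] at h

/-- `ρ = e^{π i / 3}`. -/
def rho : ℍ := ⟨Complex.exp (Real.pi * Complex.I / 3), rho_im_pos⟩

/-- `ρ²`. -/
def rhoSq : ℍ := ⟨Complex.exp (Real.pi * Complex.I / 3) ^ 2, rhoSq_im_pos⟩

/-- The geodesic from `ρ` to `ρ²`, an arc of the unit circle. -/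
def arc : Path rho rhoSq where
  toFun t := ⟨Complex.exp (Real.pi / 3 * (1 + (t : ℝ)) * Complex.I), arc_im_pos t⟩
  continuous_toFun := Continuous.upperHalfPlaneMk (by fun_prop) _
  source' := by
    apply UpperHalfPlane.ext
    simp only [rho]
    congr 1
    simp; ring
  target' := by
    apply UpperHalfPlane.ext
    simp only [rhoSq]
    rw [← Complex.exp_nat_mul]
    congr 1
    simp; ring

/-- The point `i y` of the upper half-plane, for `y > 0`. -/
def imAxis (y : ℝ) : ℍ := UpperHalfPlane.ofComplex (y * Complex.I)

theorem coe_imAxis {y : ℝ} (hy : 0 < y) : (imAxis y : ℂ) = y * Complex.I := by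
  rw [imAxis, UpperHalfPlane.ofComplex_apply_of_im_pos (by simpa using hy)]

theorem im_imAxis {y : ℝ} (hy : 0 < y) : (imAxis y).im = y := by
  rw [← UpperHalfPlane.coe_im, coe_imAxis hy]; simp

theorem continuousAt_imAxis {y : ℝ} (hy : 0 < y) : ContinuousAt imAxis y := by
  rw [UpperHalfPlane.isEmbedding_coe.continuousAt_iff]
  have : (fun y : ℝ => (y : ℂ) * Complex.I) =ᶠ[nhds y] UpperHalfPlane.coe ∘ imAxis := by
    filter_upwards [lt_mem_nhds hy] with a ha
    exact (coe_imAxis ha).symm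
  exact ContinuousAt.congr (by fun_prop) this

/-- The imaginary axis from `0` to `∞`, as a map on the unit interval: `t ↦ i t / (1 - t)`. -/
def axisFun (t : unitInterval) : HStar :=
  if (t : ℝ) = 0 then cusp ((0 : ℚ) : OnePoint ℚ)
  else if (t : ℝ) = 1 then cusp OnePoint.infty
  else pt (imAxis (t / (1 - t)))

theorem S_smul_imAxis {y : ℝ} (hy : 0 < y) : ModularGroup.S • imAxis y⁻¹ = imAxis y := by
  apply UpperHalfPlane.ext
  rw [UpperHalfPlane.modular_S_smul, coe_imAxis hy, UpperHalfPlane.coe_mk,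
    coe_imAxis (inv_pos.2 hy)]
  have : (y : ℂ) ≠ 0 := by exact_mod_cast hy.ne'
  push_cast
  field_simp
  simp

theorem S_smul_cusp : ModularGroup.S • cusp OnePoint.infty = cusp ((0 : ℚ) : OnePoint ℚ) := by
  rw [smul_cusp, OnePoint.smul_infty_eq_ite]
  simp [ModularGroup.coe_S]

theorem continuous_axisFun : Continuous axisFun := by
  refine ⟨fun U hU => isOpen_iff_mem_nhds.2 fun t ht => ?_⟩
  have hc : Continuous fun u : unitInterval => (u : ℝ) := continuous_subtype_val
  change axisFun t ∈ U at ht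
  by_cases h0 : (t : ℝ) = 0
  · rw [axisFun, if_pos h0, ← S_smul_cusp] at ht
    obtain ⟨B, hB⟩ := hU.2 _ ht
    have hlt : (t : ℝ) < 1 / (|B| + 2) := by rw [h0]; positivity
    filter_upwards [hc.continuousAt.eventually (gt_mem_nhds hlt)] with u hu
    change axisFun u ∈ U
    by_cases hu0 : (u : ℝ) = 0
    · rw [axisFun, if_pos hu0, ← S_smul_cusp]; exact ht
    have hpos : 0 < (u : ℝ) := lt_of_le_of_ne u.2.1 (Ne.symm hu0)
    have hB2 : 0 < |B| + 2 := by positivity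
    rw [lt_div_iff₀ hB2] at hu
    have hu1 : (u : ℝ) < 1 := by nlinarith [abs_nonneg B]
    have hq : 0 < (u : ℝ) / (1 - u) := div_pos hpos (sub_pos.2 hu1)
    rw [axisFun, if_neg hu0, if_neg hu1.ne, ← S_smul_imAxis hq, ← smul_pt]
    apply hB
    rw [im_imAxis (inv_pos.2 hq), inv_div, lt_div_iff₀ hpos]
    nlinarith [le_abs_self B]
  by_cases h1 : (t : ℝ) = 1
  · rw [axisFun, if_neg h0, if_pos h1] at ht
    obtain ⟨B, hB⟩ := hU.2 1 (by rwa [one_smul])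
    have hlt : 1 - 1 / (|B| + 2) < (t : ℝ) := by
      rw [h1]
      have : 0 < 1 / (|B| + 2) := by positivity
      linarith
    filter_upwards [hc.continuousAt.eventually (lt_mem_nhds hlt)] with u hu
    change axisFun u ∈ U
    have hB2 : 0 < |B| + 2 := by positivity
    have hu' : (1 - (u : ℝ)) * (|B| + 2) < 1 := by
      rw [← lt_div_iff₀ hB2]; linarith
    have hpos : 0 < (u : ℝ) := by
      nlinarith [abs_nonneg B, u.2.1]
    by_cases hu1 : (u : ℝ) = 1
    · rw [axisFun, if_neg hpos.ne', if_pos hu1]; exact ht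
    have hlt1 : 0 < 1 - (u : ℝ) := sub_pos.2 (lt_of_le_of_ne u.2.2 hu1)
    have hq : 0 < (u : ℝ) / (1 - u) := div_pos hpos hlt1
    rw [axisFun, if_neg hpos.ne', if_neg hu1, ← one_smul SL(2, ℤ) (pt _)]
    apply hB
    rw [im_imAxis hq, lt_div_iff₀ hlt1]
    nlinarith [le_abs_self B]
  · have hpos : 0 < (t : ℝ) := lt_of_le_of_ne t.2.1 (Ne.symm h0)
    have hlt1 : 0 < 1 - (t : ℝ) := sub_pos.2 (lt_of_le_of_ne t.2.2 h1)
    have hq : 0 < (t : ℝ) / (1 - t) := div_pos hpos hlt1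
    have hcont : ContinuousAt (fun u : unitInterval => pt (imAxis ((u : ℝ) / (1 - u)))) t := by
      have h2 : ContinuousAt (fun u : unitInterval => (u : ℝ) / (1 - u)) t :=
        hc.continuousAt.div (continuous_const.sub hc).continuousAt hlt1.ne'
      exact continuous_pt.continuousAt.comp
        (ContinuousAt.comp (f := fun u : unitInterval => (u : ℝ) / (1 - u))
          (continuousAt_imAxis hq) h2)
    rw [axisFun, if_neg h0, if_neg h1] at ht
    filter_upwards [hcont.eventually (hU.mem_nhds ht), hc.continuousAt.eventually_ne h0,
      hc.continuousAt.eventually_ne h1] with u hu hu0 hu1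
    change axisFun u ∈ U
    rw [axisFun, if_neg hu0, if_neg hu1]
    exact hu

/-- The geodesic from `0` to `∞` in `ℍ ∪ ℙ¹(ℚ)`, that is the imaginary axis. -/
def axis : Path (cusp ((0 : ℚ) : OnePoint ℚ)) (cusp OnePoint.infty) where
  toFun := axisFun
  continuous_toFun := continuous_axisFun
  source' := by simp [axisFun]
  target' := by simp [axisFun]

/-! ### Complex conjugation -/

/-- Complex conjugation `z ↦ -z̄` on `ℍ`. -/
def conjH (z : ℍ) : ℍ := ⟨-(starRingEnd ℂ) z, by simpa using z.im_pos⟩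

theorem continuous_conjH : Continuous conjH :=
  Continuous.upperHalfPlaneMk (Complex.continuous_conj.comp UpperHalfPlane.continuous_coe).neg _

/-- The automorphism `(a, b; c, d) ↦ (a, -b; -c, d)` of `SL₂(ℤ)`. -/
def twist (g : SL(2, ℤ)) : SL(2, ℤ) :=
  ⟨!![g 0 0, -g 0 1; -g 1 0, g 1 1], by
    have := g.det_coe
    rw [Matrix.det_fin_two] at this
    rw [Matrix.det_fin_two_of]
    linarith⟩

theorem conjH_smul (g : SL(2, ℤ)) (z : ℍ) : conjH (g • z) = twist g • conjH z := by
  apply UpperHalfPlane.ext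
  rw [UpperHalfPlane.coe_specialLinearGroup_apply]
  simp only [conjH, UpperHalfPlane.coe_specialLinearGroup_apply, twist]
  simp
  rw [← neg_div]
  congr 1
  ring

theorem twist_mem {N : ℕ} {g : SL(2, ℤ)} (hg : g ∈ CongruenceSubgroup.Gamma1 N) :
    twist g ∈ CongruenceSubgroup.Gamma1 N := by
  rw [CongruenceSubgroup.Gamma1_mem] at hg ⊢
  simpa [twist] using hg

/-- Complex conjugation on `Y₁(N)(ℂ)`, induced by `z ↦ -z̄`. -/
def conjY (N : ℕ) : C(Y1 N, Y1 N) where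
  toFun := Quotient.lift (fun z : ℍ => projY N (conjH z)) fun _ w ⟨γ, hγ⟩ =>
    Quotient.sound ⟨⟨twist γ, twist_mem γ.2⟩, by
      rw [← hγ]; exact (conjH_smul γ w).symm⟩
  continuous_toFun := ((projY N).continuous.comp continuous_conjH).quotient_lift _

/-! ### Manin symbols -/

/-- The set of vectors `(u, v) ∈ (ℤ/Nℤ)²` with `gcd(u, v, N) = 1`. -/
def E (N : ℕ) : Type :=
  {x : Fin 2 → ZMod N // Nat.gcd (Nat.gcd (x 0).val (x 1).val) N = 1}

instance (N : ℕ) [NeZero N] : Fintype (E N) :=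
  inferInstanceAs (Fintype {x : Fin 2 → ZMod N // Nat.gcd (Nat.gcd (x 0).val (x 1).val) N = 1})

theorem gcd_eq_one_iff {N : ℕ} [NeZero N] (u v : ZMod N) :
    Nat.gcd (Nat.gcd u.val v.val) N = 1 ↔ IsCoprime u v := by
  constructor
  · intro h
    have h1 := Nat.gcd_eq_gcd_ab (Nat.gcd u.val v.val) N
    rw [h, Nat.gcd_eq_gcd_ab u.val v.val] at h1
    have h2 := congrArg (Int.cast : ℤ → ZMod N) h1
    push_cast at h2
    simp only [ZMod.natCast_val, ZMod.cast_id', id_eq, CharP.cast_eq_zero, zero_mul,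
      add_zero] at h2
    exact ⟨(u.val.gcdA v.val : ZMod N) * ((u.val.gcd v.val).gcdA N : ZMod N),
      (u.val.gcdB v.val : ZMod N) * ((u.val.gcd v.val).gcdA N : ZMod N), by
        linear_combination -h2⟩
  · rintro ⟨a, b, hab⟩
    set d := Nat.gcd (Nat.gcd u.val v.val) N with hd
    have hdN : d ∣ N := Nat.gcd_dvd_right _ _
    have hdu : d ∣ u.val := (Nat.gcd_dvd_left _ _).trans (Nat.gcd_dvd_left _ _)
    have hdv : d ∣ v.val := (Nat.gcd_dvd_left _ _).trans (Nat.gcd_dvd_right _ _)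
    have h0 : ∀ w : ZMod N, d ∣ w.val → ZMod.castHom hdN (ZMod d) w = 0 := by
      intro w hw
      rw [← ZMod.natCast_zmod_val w, map_natCast]
      exact (ZMod.natCast_eq_zero_iff _ _).2 hw
    have h1 := congrArg (ZMod.castHom hdN (ZMod d)) hab
    rw [map_add, map_mul, map_mul, h0 u hdu, h0 v hdv, map_one, mul_zero, mul_zero,
      add_zero] at h1
    have h2 : ((1 : ℕ) : ZMod d) = 0 := by rw [Nat.cast_one]; exact h1.symm
    exact Nat.dvd_one.1 ((ZMod.natCast_eq_zero_iff _ _).1 h2)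

/-- The right action `x ↦ x g` of `SL₂(ℤ)` on row vectors. -/
def E.act {N : ℕ} [NeZero N] (x : E N) (g : SL(2, ℤ)) : E N :=
  ⟨Matrix.vecMul x.1 ((g : Matrix (Fin 2) (Fin 2) ℤ).map (Int.cast : ℤ → ZMod N)),
    (gcd_eq_one_iff _ _).2 (((gcd_eq_one_iff _ _).1 x.2).vecMulSL
      (Matrix.SpecialLinearGroup.map (Int.castRingHom (ZMod N)) g))⟩

/-- `x = (u, v) ↦ xᶜ = (-u, v)`. -/
def E.conj {N : ℕ} [NeZero N] (x : E N) : E N :=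
  ⟨![-x.1 0, x.1 1], (gcd_eq_one_iff _ _).2 
    ((gcd_eq_one_iff _ _).1 x.2).neg_left⟩

/-- The matrix `τ = (0, -1; 1, -1)`. -/
def tau : SL(2, ℤ) := ⟨!![0, -1; 1, -1], by simp [Matrix.det_fin_two_of]⟩

/-- `g` chooses, for every `x ∈ E_N`, a matrix `g_x ∈ SL₂(ℤ)` whose bottom row is congruent to `x`
modulo `N`. -/
def IsLift {N : ℕ} (g : E N → SL(2, ℤ)) : Prop :=
  ∀ (x : E N) (j : Fin 2), ((g x 1 j : ℤ) : ZMod N) = x.1 j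

/-- `-i ∫_{γ0}^{γ∞} f(z) dz`, the integral being taken along the image under `γ` of the imaginary
axis. -/
def period {N : ℕ} (f : CuspForm (CongruenceSubgroup.Gamma1 N) 2) (γ : SL(2, ℤ)) : ℂ :=
  -Complex.I * ∫ y in Set.Ioi (0 : ℝ),
    f (γ • imAxis y) * deriv (fun u : ℝ => ((γ • imAxis u : ℍ) : ℂ)) y

section Symbols

variable {N : ℕ} [NeZero N]

/-- The Manin symbol `ξ_f(x) = -i ∫_{g_x 0}^{g_x ∞} f(z) dz`. -/
def xiForm (g : E N → SL(2, ℤ)) (f : CuspForm (CongruenceSubgroup.Gamma1 N) 2) (x : E N) : ℂ :=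
  period f (g x)

/-- `ξ_f⁺(x) = (ξ_f(x) + ξ_f(xᶜ)) / 2`. -/
def xiFormPlus (g : E N → SL(2, ℤ)) (f : CuspForm (CongruenceSubgroup.Gamma1 N) 2)
    (x : E N) : ℂ :=
  1 / 2 * (xiForm g f x + xiForm g f x.conj)

end Symbols

/-- The modular symbol `{γ0, γ∞} ∈ H₁(X₁(N)(ℂ), {cusps}; ℤ)`: the class of the image of the
geodesic from `γ0` to `γ∞`. -/
def cuspSymbol (N : ℕ) (γ : SL(2, ℤ)) : H1 (X1 N) (cusps N) :=
  pathClass (cusps N) ((axis.map (continuous_smul_star γ)).map (projX N).continuous)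
    ⟨_, rfl⟩ ⟨_, rfl⟩

/-- The images in `Y₁(N)(ℂ)` of the points `γρ` and `γρ²`, for `γ ∈ SL₂(ℤ)`. -/
def rhoPoints (N : ℕ) : Set (Y1 N) :=
  {y | ∃ γ : SL(2, ℤ), y = projY N (γ • rho) ∨ y = projY N (γ • rhoSq)}

/-- The symbol `{γρ, γρ²}` in `H₁(Y₁(N)(ℂ), A; ℤ)`, where `A` is the set of images of the points
`γρ`, `γρ²`: the class of the image of the geodesic from `γρ` to `γρ²`. -/
def rhoSymbol (N : ℕ) (γ : SL(2, ℤ)) : H1 (Y1 N) (rhoPoints N) :=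
  pathClass (rhoPoints N) ((arc.map (continuous_smul_upper γ)).map (projY N).continuous)
    ⟨γ, Or.inl rfl⟩ ⟨γ, Or.inr rfl⟩

theorem rho_cube : Complex.exp (Real.pi * Complex.I / 3) ^ 3 = -1 := by
  rw [← Complex.exp_nat_mul, ← Complex.exp_pi_mul_I]
  congr 1
  push_cast
  ring

theorem conj_rho : (starRingEnd ℂ) (Complex.exp (Real.pi * Complex.I / 3)) =
    (Complex.exp (Real.pi * Complex.I / 3))⁻¹ := by
  rw [← Complex.exp_conj, ← Complex.exp_neg]
  congr 1
  simp [map_ofNat]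
  ring

theorem conjH_rho : conjH rho = rhoSq := by
  apply UpperHalfPlane.ext
  simp only [conjH, rho, rhoSq, conj_rho]
  have h := rho_cube
  have h0 := Complex.exp_ne_zero (Real.pi * Complex.I / 3)
  field_simp
  linear_combination -h

theorem conjH_rhoSq : conjH rhoSq = rho := by
  apply UpperHalfPlane.ext
  simp only [conjH, rho, rhoSq, map_pow, conj_rho]
  have h := rho_cube
  have h0 := Complex.exp_ne_zero (Real.pi * Complex.I / 3)
  field_simp
  linear_combination -h

theorem conjY_mapsTo (N : ℕ) : Set.MapsTo (conjY N) (rhoPoints N) (rhoPoints N) := by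
  rintro _ ⟨γ, rfl | rfl⟩
  · refine ⟨twist γ, Or.inr ?_⟩
    rw [← conjH_rho, ← conjH_smul]; rfl
  · refine ⟨twist γ, Or.inl ?_⟩
    rw [← conjH_rhoSq, ← conjH_smul]; rfl

section Cycles

variable {N : ℕ} [NeZero N]

/-- The relative cycle `γ_f = ∑ₓ ξ_f(x) {g_x ρ, g_x ρ²}` on `Y₁(N)(ℂ)`. -/
def gammaForm (g : E N → SL(2, ℤ)) (f : CuspForm (CongruenceSubgroup.Gamma1 N) 2) :
    ℂ ⊗[ℤ] H1 (Y1 N) (rhoPoints N) :=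
  ∑ x : E N, xiForm g f x ⊗ₜ[ℤ] rhoSymbol N (g x)

/-- The relative cycle `γ_f⁻ = (γ_f - c_* γ_f) / 2`. -/
def gammaFormMinus (g : E N → SL(2, ℤ)) (f : CuspForm (CongruenceSubgroup.Gamma1 N) 2) :
    ℂ ⊗[ℤ] H1 (Y1 N) (rhoPoints N) :=
  (1 / 2 : ℂ) • (gammaForm g f -
    (H1.map (conjY N) (conjY_mapsTo N)).baseChange ℂ (gammaForm g f))

/-- `γ` is closed: its boundary vanishes. -/
def IsClosedCycle (γ : ℂ ⊗[ℤ] H1 (Y1 N) (rhoPoints N)) : Prop :=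
  (H1.boundary (rhoPoints N)).baseChange ℂ γ = 0

/-- `δ ∈ H₁(X₁(N)(ℂ); ℤ) ⊗ ℂ` is the image of the relative cycle `γ`: there is exactly one class in
`H₁(Y₁(N)(ℂ); ℤ) ⊗ ℂ` that represents `γ`, and `δ` is its image. -/
def IsImageInX (γ : ℂ ⊗[ℤ] H1 (Y1 N) (rhoPoints N)) (δ : ℂ ⊗[ℤ] H1 (X1 N) ∅) : Prop :=
  ∃ c : ℂ ⊗[ℤ] H1 (Y1 N) ∅,
    (∀ c' : ℂ ⊗[ℤ] H1 (Y1 N) ∅, (H1.toRel (rhoPoints N)).baseChange ℂ c' = γ ↔ c' = c) ∧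
    (H1.push (inclYX N)).baseChange ℂ c = δ

/-- `-1/3 ∑ₓ (φ(x) + 2 φ(xτ)) ξ(x)`, where `ξ(x) = {g_x 0, g_x ∞}`, in
`H₁(X₁(N)(ℂ), {cusps}; ℤ) ⊗ ℂ`. -/
def symbolSum (g : E N → SL(2, ℤ)) (φ : E N → ℂ) : ℂ ⊗[ℤ] H1 (X1 N) (cusps N) :=
  -(1 / 3 : ℂ) • ∑ x : E N, (φ x + 2 * φ (x.act tau)) ⊗ₜ[ℤ] cuspSymbol N (g x)

end Cycles

end ModSym

end

/-! Both kinds of symbols are cut along the geodesics from `γρ` to `∞`. Let `v(γ)` be the class of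
the image in `X₁(N)` of the geodesic from `γρ` to `γ∞`, taken in the quotient of all 1-chains by the
boundaries relative to the cusps. It depends only on the bottom row of `γ` modulo `N`. Since `τ`
fixes `ρ` and sends `∞` to `0`, `{γ0, γ∞} = v(γ) - v(γτ)`. Since `T⁻¹` fixes `∞` and sends `ρ` to
`ρ²`, `{γρ, γρ²} = v(γ) - v(γT⁻¹)`. These are `toChainQuot_cuspSymbol` and `mapChainQuot_rhoSymbol`.

The coefficients satisfy the Manin relations `φ(xS) = -φ(x)` and `φ(x) + φ(xτ) + φ(xτ²) = 0`. For
periods (`period_manin`), a primitive of `f` has limits at the cusps that are unchanged by `T` and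
by `-1`, and the relations telescope over the ends of a geodesic and over an ideal triangle. Given
these relations and `T = τ²S`, comparing the coefficients of `v` on both sides leaves `-φ(xτ)` each
time (`IsManin.mapChainQuot_rhoCycle`). Closedness also follows: the `S`-relation turns the boundary
into `-2 ∑ φ(x) [g_x ρ]`, and the `τ`-relation kills this sum because `[g_x ρ]` is invariant under
`τ`.

The absolute class exists by the exact sequence of the pair, and it is unique because the set of
images of `ρ` and `ρ²` is finite in a Hausdorff space, hence discrete; flatness of `ℂ` over `ℤ`
carries both facts to complex coefficients. The minus part is the same theorem for `ξ_f⁺`: complex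
conjugation reverses the arc from `ρ` to `ρ²`, and `x ↦ xᶜ` preserves the Manin relations. -/

namespace ModSym

/-! ### Periods of cusp forms and their Manin relations -/

section Periods

open UpperHalfPlane Filter Topology MeasureTheory
open scoped ModularForm

/-- A holomorphic function on the upper half-plane has a primitive. -/
theorem exists_primitive_upperHalfPlane {F : ℂ → ℂ}
    (hF : DifferentiableOn ℂ F {z | 0 < z.im}) :
    ∃ G : ℂ → ℂ, ∀ z : ℂ, 0 < z.im → HasDerivAt G (F z) z := by
  have hball : ∀ w : ℂ, w ∈ Metric.ball (0 : ℂ) 1 → 1 - w ≠ 0 := by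
    intro w hw h
    rw [← sub_eq_zero.1 h] at hw
    simp at hw
  have him : ∀ w : ℂ, w ∈ Metric.ball (0 : ℂ) 1 → 0 < (Complex.I * (1 + w) / (1 - w)).im := by
    intro w hw
    have h1 : 0 < Complex.normSq (1 - w) := Complex.normSq_pos.2 (hball w hw)
    have h2 : Complex.normSq w < 1 := by
      rw [Complex.normSq_eq_norm_sq]
      have : ‖w‖ < 1 := by simpa using hw
      nlinarith [norm_nonneg w]
    rw [Complex.normSq_apply] at h2
    have h3 : (Complex.I * (1 + w) / (1 - w)).im
        = (1 - (w.re * w.re + w.im * w.im)) / Complex.normSq (1 - w) := by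
      rw [Complex.div_im]
      simp
      field_simp
      ring
    rw [h3]
    exact div_pos (by linarith) h1
  have hd : ∀ w : ℂ, w ∈ Metric.ball (0 : ℂ) 1 →
      HasDerivAt (fun w : ℂ => Complex.I * (1 + w) / (1 - w)) (2 * Complex.I / (1 - w) ^ 2) w := by
    intro w hw
    convert! (((hasDerivAt_id w).const_add 1).const_mul Complex.I).div
      ((hasDerivAt_id w).const_sub 1) (hball w hw) using 1
    simp only [id]
    ring
  -- The form `F(z) dz` is pulled back by the Cayley transform to the unit disc, where holomorphic
  -- functions have primitives.
  have hK : DifferentiableOn ℂ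
      (fun w : ℂ => F (Complex.I * (1 + w) / (1 - w)) * (2 * Complex.I / (1 - w) ^ 2))
      (Metric.ball 0 1) := by
    refine DifferentiableOn.mul
      (hF.comp (fun w hw => (hd w hw).differentiableAt.differentiableWithinAt) him) ?_
    intro w hw
    have := hball w hw
    refine DifferentiableAt.differentiableWithinAt ?_
    exact (differentiableAt_const _).div ((differentiableAt_id.const_sub 1).pow 2)
      (pow_ne_zero 2 this)
  obtain ⟨K, hK⟩ := hK.isExactOn_ball
  refine ⟨fun z => K ((z - Complex.I) / (z + Complex.I)), fun z hz => ?_⟩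
  have hz0 : z + Complex.I ≠ 0 := by
    intro h
    have := congrArg Complex.im h
    simp at this
    linarith
  have hmem : (z - Complex.I) / (z + Complex.I) ∈ Metric.ball (0 : ℂ) 1 := by
    rw [mem_ball_zero_iff, norm_div, div_lt_one (norm_pos_iff.2 hz0)]
    refine lt_of_pow_lt_pow_left₀ 2 (norm_nonneg _) ?_
    rw [← Complex.normSq_eq_norm_sq, ← Complex.normSq_eq_norm_sq, Complex.normSq_apply,
      Complex.normSq_apply]
    simp
    nlinarith
  have h1 : HasDerivAt (fun z : ℂ => (z - Complex.I) / (z + Complex.I))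
      (2 * Complex.I / (z + Complex.I) ^ 2) z := by
    convert! ((hasDerivAt_id z).sub_const Complex.I).div
      ((hasDerivAt_id z).add_const Complex.I) hz0 using 1
    simp only [id]
    ring
  have h2 := (hK _ hmem).comp z h1
  convert! h2 using 1
  have e1 : 1 - (z - Complex.I) / (z + Complex.I) = 2 * Complex.I / (z + Complex.I) := by
    field_simp; ring
  have e2 : Complex.I * (1 + (z - Complex.I) / (z + Complex.I)) /
      (1 - (z - Complex.I) / (z + Complex.I)) = z := by
    rw [e1]
    have := Complex.I_ne_zero
    field_simp
    ring
  beta_reduce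
  rw [e2, e1]
  have := Complex.I_ne_zero
  field_simp

theorem hasDerivAt_smul_ofComplex (γ : SL(2, ℤ)) (z : ℍ) :
    HasDerivAt (fun w : ℂ => ((γ • ofComplex w : ℍ) : ℂ)) (1 / denom γ z ^ 2) z := by
  have hdet : (γ : GL (Fin 2) ℝ).val.det = 1 :=
    (Matrix.SpecialLinearGroup.map (Int.castRingHom ℝ) γ).det_coe
  have h := (hasStrictDerivAt_smul (g := (γ : GL (Fin 2) ℝ)) (by rw [hdet]; exact one_pos)
    z).hasDerivAt
  rw [hdet, Complex.ofReal_one] at h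
  exact h

/-- In weight two the slash action is the pullback of `f(z) dz`, so composing a primitive of `f`
with `γ` gives a primitive of `f ∣ γ`. -/
theorem hasDerivAt_comp_smul {f : ℍ → ℂ} {G : ℂ → ℂ}
    (hG : ∀ z : ℍ, HasDerivAt G (f z) z) (γ : SL(2, ℤ)) (z : ℍ) :
    HasDerivAt (fun w : ℂ => G ((γ • ofComplex w : ℍ) : ℂ)) ((f ∣[(2 : ℤ)] γ) z) z := by
  have h : HasDerivAt G (f (γ • z)) ((γ • ofComplex (z : ℂ) : ℍ) : ℂ) := by
    rw [ofComplex_apply]; exact hG _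
  convert! h.comp (z : ℂ) (hasDerivAt_smul_ofComplex γ z) using 1
  rw [ModularForm.SL_slash_apply, zpow_neg, one_div]
  rfl

theorem hasDerivAt_smul_imAxis (γ : SL(2, ℤ)) {y : ℝ} (hy : 0 < y) :
    HasDerivAt (fun u : ℝ => ((γ • imAxis u : ℍ) : ℂ))
      (1 / denom γ (imAxis y) ^ 2 * Complex.I) y := by
  have h := hasDerivAt_smul_ofComplex γ (imAxis y)
  rw [coe_imAxis hy] at h ⊢
  have h2 : HasDerivAt (fun u : ℝ => (u : ℂ) * Complex.I) Complex.I y := by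
    simpa using (Complex.ofRealCLM.hasDerivAt (x := y)).mul_const Complex.I
  exact (h.comp y h2 :)

variable {N : ℕ} (f : CuspForm (CongruenceSubgroup.Gamma1 N) 2)

theorem period_eq_integral_slash (γ : SL(2, ℤ)) :
    period f γ = -Complex.I * ∫ y in Set.Ioi (0 : ℝ),
      ((f : ℍ → ℂ) ∣[(2 : ℤ)] γ) (imAxis y) * Complex.I := by
  rw [period]
  congr 1
  refine setIntegral_congr_fun measurableSet_Ioi fun y hy => ?_
  rw [(hasDerivAt_smul_imAxis γ hy).deriv, ModularForm.SL_slash_apply, zpow_neg, one_div,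
    mul_assoc]
  rfl

theorem period_mul_left {δ : SL(2, ℤ)} (hδ : δ ∈ CongruenceSubgroup.Gamma1 N) (γ : SL(2, ℤ)) :
    period f (δ * γ) = period f γ := by
  have h : (f : ℍ → ℂ) ∣[(2 : ℤ)] δ = f :=
    SlashInvariantFormClass.slash_action_eq f _ ⟨δ, hδ, rfl⟩
  rw [period_eq_integral_slash, period_eq_integral_slash, SlashAction.slash_mul, h]

theorem continuous_slash (γ : SL(2, ℤ)) : Continuous ((f : ℍ → ℂ) ∣[(2 : ℤ)] γ) :=
  (CuspFormClass.holo (CuspForm.translate f (γ : GL (Fin 2) ℝ))).continuous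

variable [NeZero N]

open Pointwise in
-- The translate `f ∣ γ` is a cusp form for a conjugate of `Γ₁(N)`, which is again arithmetic, so
-- exponential decay at `∞` applies to it.
theorem slash_exp_decay (γ : SL(2, ℤ)) :
    ∃ c > 0, ((f : ℍ → ℂ) ∣[(2 : ℤ)] γ) =O[atImInfty] fun z => Real.exp (-c * z.im) := by
  have : (ConjAct.toConjAct (γ : GL (Fin 2) ℝ)⁻¹ •
      (CongruenceSubgroup.Gamma1 N : Subgroup (GL (Fin 2) ℝ))).IsArithmetic := by
    convert Subgroup.IsArithmetic.conj
      (CongruenceSubgroup.Gamma1 N : Subgroup (GL (Fin 2) ℝ)) ↑(γ⁻¹)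
    ext i j
    simp [Function.comp_def]
  exact CuspFormClass.exp_decay_atImInfty' (CuspForm.translate f (γ : GL (Fin 2) ℝ))

theorem tendsto_imAxis_atImInfty : Tendsto imAxis atTop atImInfty := by
  refine tendsto_comap_iff.2 (tendsto_id.congr' ?_)
  filter_upwards [eventually_gt_atTop 0] with y hy
  exact (im_imAxis hy).symm

theorem integrableOn_slash_imAxis (γ : SL(2, ℤ)) :
    IntegrableOn (fun y => ((f : ℍ → ℂ) ∣[(2 : ℤ)] γ) (imAxis y) * Complex.I) (Set.Ioi 1) := by
  obtain ⟨c, hc, hO⟩ := slash_exp_decay f γ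
  have hcont : ContinuousOn (fun y => ((f : ℍ → ℂ) ∣[(2 : ℤ)] γ) (imAxis y) * Complex.I)
      (Set.Ici 1) := fun y hy =>
    (((continuous_slash f γ).continuousAt.comp
      (continuousAt_imAxis (zero_lt_one.trans_le hy))).mul continuousAt_const).continuousWithinAt
  have h1 : IntegrableOn (fun y => ‖((f : ℍ → ℂ) ∣[(2 : ℤ)] γ) (imAxis y) * Complex.I‖)
      (Set.Ioi 1) := by
    refine integrable_of_isBigO_exp_neg hc hcont.norm ?_
    refine Asymptotics.IsBigO.norm_left ?_
    have h2 := hO.comp_tendsto tendsto_imAxis_atImInfty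
    refine (Asymptotics.IsBigO.of_norm_left ?_).trans_eventuallyEq
      (g₁ := (fun z : ℍ => Real.exp (-c * z.im)) ∘ imAxis) ?_
    · simpa using h2.norm_left
    · filter_upwards [eventually_gt_atTop 0] with y hy
      simp [im_imAxis hy]
  refine (integrable_norm_iff ?_).1 h1
  exact (hcont.mono Set.Ioi_subset_Ici_self).aestronglyMeasurable measurableSet_Ioi

/-- The limits at the cusps of a primitive of `f`. -/
theorem exists_cusp_limits :
    ∃ G : ℂ → ℂ, (∀ z : ℍ, HasDerivAt G (f z) z) ∧ ∃ l : SL(2, ℤ) → ℂ, ∀ γ,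
      Tendsto (fun t : ℝ => G ((γ • imAxis (Real.exp t) : ℍ) : ℂ)) atTop (𝓝 (l γ)) ∧
      period f γ = -Complex.I * (l γ - l (γ * ModularGroup.S)) := by
  have hol : DifferentiableOn ℂ ((f : ℍ → ℂ) ∘ ofComplex) {z | 0 < z.im} :=
    mdifferentiable_iff.1 (CuspFormClass.holo f)
  obtain ⟨G, hG⟩ := exists_primitive_upperHalfPlane hol
  have hG' : ∀ z : ℍ, HasDerivAt G (f z) z := fun z => by
    simpa using hG z z.im_pos
  -- The logarithmic coordinate `y = e^t` turns the action of `S` on the imaginary axis into `t ↦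
  -- -t`, so the end at `0` for `γ` is the end at `∞` for `γS`.
  have hder : ∀ (γ : SL(2, ℤ)) (t : ℝ),
      HasDerivAt (fun t : ℝ => G ((γ • imAxis (Real.exp t) : ℍ) : ℂ))
        (Real.exp t • (((f : ℍ → ℂ) ∣[(2 : ℤ)] γ) (imAxis (Real.exp t)) * Complex.I)) t := by
    intro γ t
    have h := hasDerivAt_comp_smul hG' γ (imAxis (Real.exp t))
    rw [coe_imAxis (Real.exp_pos t)] at h
    have h2 : HasDerivAt (fun t : ℝ => ((Real.exp t : ℝ) : ℂ) * Complex.I)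
        (((Real.exp t : ℝ) : ℂ) * Complex.I) t :=
      (Real.hasDerivAt_exp t).ofReal_comp.mul_const Complex.I
    convert! h.comp t h2 using 1
    rw [Complex.real_smul]
    ring
  have hint : ∀ γ : SL(2, ℤ), IntegrableOn (fun t : ℝ =>
      Real.exp t • (((f : ℍ → ℂ) ∣[(2 : ℤ)] γ) (imAxis (Real.exp t)) * Complex.I))
      (Set.Ioi 0) := fun γ => by
    rw [integrableOn_comp_exp_Ioi
      (fun y => ((f : ℍ → ℂ) ∣[(2 : ℤ)] γ) (imAxis y) * Complex.I), Real.exp_zero]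
    exact integrableOn_slash_imAxis f γ
  have hlim := fun γ : SL(2, ℤ) =>
    tendsto_limUnder_of_hasDerivAt_of_integrableOn_Ioi (fun t _ => hder γ t) (hint γ)
  refine ⟨G, hG', fun γ => _, fun γ => ⟨hlim γ, ?_⟩⟩
  have hrefl : ∀ t : ℝ, G ((γ • imAxis (Real.exp t) : ℍ) : ℂ) =
      G (((γ * ModularGroup.S) • imAxis (Real.exp (-t)) : ℍ) : ℂ) := fun t => by
    rw [mul_smul, Real.exp_neg, S_smul_imAxis (Real.exp_pos t)]
  have hbot : Tendsto (fun t : ℝ => G ((γ • imAxis (Real.exp t) : ℍ) : ℂ)) atBot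
      (𝓝 (limUnder atTop fun t : ℝ =>
        G (((γ * ModularGroup.S) • imAxis (Real.exp t) : ℍ) : ℂ))) := by
    refine ((hlim (γ * ModularGroup.S)).comp tendsto_neg_atBot_atTop).congr fun t => ?_
    exact (hrefl t).symm
  -- Both sides are derivatives of the same function of `t`; this transfers integrability from the
  -- half-line at `+∞` for `γS` to the half-line at `-∞` for `γ`.
  have hder' : ∀ t : ℝ,
      Real.exp t • (((f : ℍ → ℂ) ∣[(2 : ℤ)] γ) (imAxis (Real.exp t)) * Complex.I) =
      -(Real.exp (-t) • (((f : ℍ → ℂ) ∣[(2 : ℤ)] (γ * ModularGroup.S))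
        (imAxis (Real.exp (-t))) * Complex.I)) := by
    intro t
    have h1 := hder γ t
    have h2 := (hder (γ * ModularGroup.S) (-t)).scomp t (hasDerivAt_neg t)
    have h3 := h1.unique (h2.congr_of_eventuallyEq (Eventually.of_forall hrefl))
    simpa using h3
  have hintR : Integrable (fun t : ℝ =>
      Real.exp t • (((f : ℍ → ℂ) ∣[(2 : ℤ)] γ) (imAxis (Real.exp t)) * Complex.I)) := by
    rw [← integrableOn_univ, ← Set.Iic_union_Ioi (a := (0 : ℝ))]
    refine IntegrableOn.union ?_ (hint γ)
    have h1 := ((hint (γ * ModularGroup.S)).neg).comp_neg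
    rw [integrableOn_Iic_iff_integrableOn_Iio]
    refine (integrableOn_congr_fun (fun t _ => hder' t) measurableSet_Iio).2 ?_
    simpa using h1
  rw [period_eq_integral_slash, ← Real.range_exp, ← Set.image_univ,
    integral_image_eq_integral_abs_deriv_smul MeasurableSet.univ
      (fun t _ => (Real.hasDerivAt_exp t).hasDerivWithinAt) Real.exp_injective.injOn,
    setIntegral_univ, ← integral_of_hasDerivAt_of_tendsto (hder γ) hintR hbot (hlim γ)]
  simp only [abs_of_pos (Real.exp_pos _)]

/-- `T` moves a point of the imaginary axis horizontally by `1`, and the derivative `f ∣ γ` of `G ∘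
γ` is uniformly small at great height. -/
theorem cusp_limit_mul_T {G : ℂ → ℂ} (hG : ∀ z : ℍ, HasDerivAt G (f z) z) (γ : SL(2, ℤ)) :
    Tendsto (fun t : ℝ => G (((γ * ModularGroup.T) • imAxis (Real.exp t) : ℍ) : ℂ) -
      G ((γ • imAxis (Real.exp t) : ℍ) : ℂ)) atTop (𝓝 0) := by
  have hz : IsZeroAtImInfty ((f : ℍ → ℂ) ∣[(2 : ℤ)] γ) := CuspFormClass.zero_at_infty_slash f γ
  rw [isZeroAtImInfty_iff] at hz
  rw [Metric.tendsto_atTop]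
  intro ε hε
  obtain ⟨A, hA⟩ := hz (ε / 2) (half_pos hε)
  -- The bound on the height serves as a bound on `t` too, since `e^t ≥ t + 1`.
  refine ⟨A, fun t ht => ?_⟩
  have hexp : A ≤ Real.exp t := ht.trans (by linarith [Real.add_one_le_exp t])
  have hpos := Real.exp_pos t
  set s : Set ℂ := {z : ℂ | z.im = Real.exp t} with hs
  have hconv : Convex ℝ s := by
    intro z hz w hw a b _ _ hab
    simp only [hs, Set.mem_ofPred_eq] at hz hw ⊢
    simp [hz, hw, ← add_mul, hab]
  -- Mean value inequality on the horizontal line; the bound `ε / 2` makes up for its not being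
  -- strict.
  have hle := hconv.norm_image_sub_le_of_norm_hasDerivWithin_le
    (f := fun w : ℂ => G ((γ • ofComplex w : ℍ) : ℂ))
    (f' := fun w : ℂ => ((f : ℍ → ℂ) ∣[(2 : ℤ)] γ) (ofComplex w)) (C := ε / 2)
    (x := ((Real.exp t : ℝ) : ℂ) * Complex.I) (y := ((Real.exp t : ℝ) : ℂ) * Complex.I + 1)
    (fun w hw => ?_) (fun w hw => ?_) ?_ ?_
  · rw [dist_zero_right]
    have e : ((γ * ModularGroup.T) • imAxis (Real.exp t) : ℍ) =
        γ • ofComplex (((Real.exp t : ℝ) : ℂ) * Complex.I + 1) := by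
      rw [mul_smul]
      congr 1
      apply UpperHalfPlane.ext
      rw [modular_T_smul, coe_vadd, coe_imAxis hpos,
        ofComplex_apply_of_im_pos (by simpa [-Complex.ofReal_exp] using hpos)]
      simp [add_comm]
    rw [e]
    refine lt_of_le_of_lt hle ?_
    simpa using half_lt_self hε
  · have hw' : 0 < w.im := by rw [show w.im = _ from hw]; exact hpos
    have := hasDerivAt_comp_smul hG γ ⟨w, hw'⟩
    rw [ofComplex_apply_of_im_pos hw']
    exact this.hasDerivWithinAt
  · have hw' : 0 < w.im := by rw [show w.im = _ from hw]; exact hpos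
    apply hA
    rw [ofComplex_apply_of_im_pos hw']
    change A ≤ w.im
    rwa [show w.im = _ from hw]
  · simp [hs, -Complex.ofReal_exp]
  · simp [hs, -Complex.ofReal_exp]

theorem tau_eq : tau = ModularGroup.S * ModularGroup.T⁻¹ := by
  rw [eq_mul_inv_iff_mul_eq]
  decide

theorem tau_mul_tau_mul_S : tau * tau * ModularGroup.S = ModularGroup.T := by decide

theorem S_mul_S : ModularGroup.S * ModularGroup.S = -1 := by decide

theorem tau_cube : tau * tau * tau = 1 := by decide

/-- The Manin relations for the periods of a cusp form. -/
theorem period_manin (γ : SL(2, ℤ)) :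
    period f (γ * ModularGroup.S) = -period f γ ∧
      period f γ + period f (γ * tau) + period f (γ * (tau * tau)) = 0 := by
  obtain ⟨G, hG, l, hl⟩ := exists_cusp_limits f
  have hT : ∀ γ, l (γ * ModularGroup.T) = l γ := fun γ =>
    sub_eq_zero.1 (tendsto_nhds_unique ((hl _).1.sub (hl γ).1) (cusp_limit_mul_T f hG γ))
  have hT' : ∀ γ, l (γ * ModularGroup.T⁻¹) = l γ := fun γ => by
    rw [← hT (γ * ModularGroup.T⁻¹), inv_mul_cancel_right]
  have hneg : ∀ γ, l (γ * -1) = l γ := fun γ => by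
    refine tendsto_nhds_unique (hl _).1 ((hl γ).1.congr fun t => ?_)
    rw [mul_smul]
    congr 3
    rw [ModularGroup.SL_neg_smul, one_smul]
  -- With `l` constant on right cosets of the stabilizer of `∞`, each of the three geodesics ends
  -- where the next begins: the vertices are `γ∞`, `γτ∞` and `γτ²∞`.
  have h1 : l (γ * tau) = l (γ * ModularGroup.S) := by rw [tau_eq, ← mul_assoc, hT']
  have h2 : l (γ * (tau * tau)) = l (γ * tau * ModularGroup.S) := by
    nth_rw 2 [tau_eq]
    rw [← mul_assoc, ← mul_assoc, hT']
  have h3 : l (γ * (tau * tau) * ModularGroup.S) = l γ := by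
    rw [mul_assoc, tau_mul_tau_mul_S, hT]
  have h4 : l (γ * ModularGroup.S * ModularGroup.S) = l γ := by rw [mul_assoc, S_mul_S, hneg]
  constructor
  · rw [(hl _).2, (hl γ).2, h4]
    ring
  · rw [(hl γ).2, (hl (γ * tau)).2, (hl (γ * (tau * tau))).2, h1, h2, h3]
    ring

end Periods

/-! ### Singular chains: explicit boundaries and the exact sequence of a pair -/

noncomputable section Homology

variable {X Y : Type*} [TopologicalSpace X] [TopologicalSpace Y]

theorem face_apply {n : ℕ} (i : Fin (n + 2)) (s : stdSimplex ℝ (Fin (n + 1))) (k : Fin (n + 2)) :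
    face i s k = ∑ j, if i.succAbove j = k then s j else 0 := by
  simp [face, stdSimplex.map_coe, FunOnFinite.linearMap_apply_apply, Finset.sum_filter]

theorem face_apply_self {n : ℕ} (i : Fin (n + 2)) (s : stdSimplex ℝ (Fin (n + 1))) :
    face i s i = 0 := by
  simp [face_apply, Fin.succAbove_ne]

theorem face_apply_succAbove {n : ℕ} (i : Fin (n + 2)) (s : stdSimplex ℝ (Fin (n + 1)))
    (j : Fin (n + 1)) : face i s (i.succAbove j) = s j := by
  simp [face_apply]

theorem bd_simplex_two (F : C(stdSimplex ℝ (Fin 3), X)) :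
    Finsupp.single (F.comp (face 0)) 1 - Finsupp.single (F.comp (face 1)) 1 +
      Finsupp.single (F.comp (face 2)) 1 ∈ LinearMap.range (bd X 1) := by
  refine ⟨Finsupp.single F 1, ?_⟩
  rw [bd_single, one_smul, Fin.sum_univ_three, sub_eq_add_neg, ← Finsupp.single_neg]
  simp

theorem continuous_coord {n : ℕ} (i : Fin n) : Continuous fun s : stdSimplex ℝ (Fin n) => s i :=
  (continuous_apply i).comp continuous_subtype_val

/-- The singular `1`-simplex that follows `p` from the parameter `a` to the parameter `b`. -/
def seg (p : C(ℝ, X)) (a b : ℝ) : C(stdSimplex ℝ (Fin 2), X) :=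
  p.comp ⟨fun s => s 0 * a + s 1 * b,
    ((continuous_coord 0).mul_const a).add ((continuous_coord 1).mul_const b)⟩

/-- The bounding triangle is `p` composed with the affine map from the 2-simplex to `ℝ` with
vertices `a`, `b`, `c`; these may come in any order. -/
theorem seg_add_seg (p : C(ℝ, X)) (a b c : ℝ) :
    Finsupp.single (seg p b c) 1 - Finsupp.single (seg p a c) 1 + Finsupp.single (seg p a b) 1 ∈
      LinearMap.range (bd X 1) := by
  have h := bd_simplex_two (p.comp ⟨fun s : stdSimplex ℝ (Fin 3) => s 0 * a + s 1 * b + s 2 * c,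
    (((continuous_coord 0).mul_const a).add ((continuous_coord 1).mul_const b)).add
      ((continuous_coord 2).mul_const c)⟩)
  convert! h using 3
  · congr 2
    refine ContinuousMap.ext fun s => ?_
    have e0 := face_apply_self 0 s
    have e1 : face 0 s 1 = s 0 := face_apply_succAbove 0 s 0
    have e2 : face 0 s 2 = s 1 := face_apply_succAbove 0 s 1
    simp [seg, e0, e1, e2]
  · congr 2
    refine ContinuousMap.ext fun s => ?_
    have e0 : face 1 s 0 = s 0 := face_apply_succAbove 1 s 0
    have e1 := face_apply_self 1 s
    have e2 : face 1 s 2 = s 1 := face_apply_succAbove 1 s 1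
    simp [seg, e0, e1, e2]
  · refine ContinuousMap.ext fun s => ?_
    have e0 : face 2 s 0 = s 0 := face_apply_succAbove 2 s 0
    have e1 : face 2 s 1 = s 1 := face_apply_succAbove 2 s 1
    have e2 := face_apply_self 2 s
    simp [seg, e0, e1, e2]

theorem seg_self_mem (p : C(ℝ, X)) (a : ℝ) :
    Finsupp.single (seg p a a) 1 ∈ LinearMap.range (bd X 1) := by
  simpa using seg_add_seg p a a a

theorem seg_symm_mem (p : C(ℝ, X)) (a b : ℝ) :
    Finsupp.single (seg p a b) 1 + Finsupp.single (seg p b a) 1 ∈ LinearMap.range (bd X 1) := by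
  have h := add_mem (seg_add_seg p a b a) (seg_self_mem p a)
  convert! h using 1
  abel

theorem const_mem_range_bd (x : X) :
    Finsupp.single (ContinuousMap.const (stdSimplex ℝ (Fin 2)) x) 1 ∈
      LinearMap.range (bd X 1) := by
  have h := seg_self_mem (ContinuousMap.const ℝ x) 0
  rwa [seg, ContinuousMap.const_comp] at h

theorem pathSimplex_eq_seg {a b : X} (p : Path a b) :
    pathSimplex p = seg ⟨p.extend, p.continuous_extend⟩ 0 1 := by
  ext s
  simp only [pathSimplex, seg, ContinuousMap.coe_mk, ContinuousMap.comp_apply, mul_zero, mul_one,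
    zero_add]
  exact (p.extend_apply ⟨stdSimplex.zero_le s 1, stdSimplex.le_one s 1⟩).symm

theorem pathSimplex_add_symm_mem {a b : X} (p : Path a b) :
    Finsupp.single (pathSimplex p) 1 + Finsupp.single (pathSimplex p.symm) 1 ∈
      LinearMap.range (bd X 1) := by
  have e : pathSimplex p.symm = seg ⟨p.extend, p.continuous_extend⟩ 1 0 := by
    ext s
    have h1 := stdSimplex.add_eq_one s
    have h0 := stdSimplex.zero_le s 0
    have h2 := stdSimplex.le_one s 0
    simp only [pathSimplex, seg, ContinuousMap.coe_mk, ContinuousMap.comp_apply, mul_zero, mul_one,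
      add_zero, Path.symm_apply]
    rw [p.extend_apply ⟨h0, h2⟩]
    refine congrArg p (Subtype.ext ?_)
    simp only [unitInterval.coe_symm_eq]
    linarith
  rw [e, pathSimplex_eq_seg]
  exact seg_symm_mem _ 0 1

theorem chainsIn_empty (n : ℕ) : chainsIn (∅ : Set X) n = ⊥ := by
  have : {σ : C(stdSimplex ℝ (Fin (n + 1)), X) | ∀ s, σ s ∈ (∅ : Set X)} = ∅ := by
    ext σ
    simp
  rw [chainsIn, this, Finsupp.supported_empty]

theorem relBoundaries_empty : relBoundaries (∅ : Set X) = LinearMap.range (bd X 1) := by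
  rw [relBoundaries, chainsIn_empty, sup_bot_eq]

/-- A simplex is connected, so a simplex in a discrete subspace is constant, and a constant
1-simplex bounds the constant 2-simplex. -/
theorem chainsIn_one_le_range_bd (A : Set X) [DiscreteTopology A] :
    chainsIn A 1 ≤ LinearMap.range (bd X 1) := by
  rw [chainsIn, Finsupp.supported_eq_span_single, Submodule.span_le]
  rintro _ ⟨σ, hσ, rfl⟩
  have hpre : PreconnectedSpace (stdSimplex ℝ (Fin 2)) :=
    Subtype.preconnectedSpace (convex_stdSimplex ℝ (Fin 2)).isPreconnected
  have hcont : Continuous fun s => (⟨σ s, hσ s⟩ : A) := σ.continuous.subtype_mk _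
  have e : σ = ContinuousMap.const _ (σ (stdSimplex.vertex 0)) := by
    ext s
    exact congrArg Subtype.val (hpre.constant hcont (x := s) (y := stdSimplex.vertex 0))
  rw [e]
  exact const_mem_range_bd _

theorem chainMap_range_bd (f : C(X, Y)) {c : Chain X 1} (hc : c ∈ LinearMap.range (bd X 1)) :
    chainMap f 1 c ∈ LinearMap.range (bd Y 1) := by
  obtain ⟨d, rfl⟩ := hc
  exact ⟨chainMap f 2 d, chainMap_bd f 1 d⟩

/-- The inclusion of `H₁(X, A; ℤ)` into the quotient of all chains by the relative boundaries. -/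
def H1.toChainQuot (A : Set X) : H1 X A →ₗ[ℤ] Chain X 1 ⧸ relBoundaries A :=
  Submodule.mapQ _ _ (relCycles A).subtype le_rfl

/-- Identities in `H₁` may thus be checked after cutting cycles into pieces that are not themselves
relative cycles. -/
theorem H1.toChainQuot_injective (A : Set X) : Function.Injective (H1.toChainQuot A) := by
  refine (injective_iff_map_eq_zero _).2 fun x hx => ?_
  obtain ⟨c, rfl⟩ := Submodule.Quotient.mk_surjective _ x
  have h : (Submodule.Quotient.mk (c : Chain X 1) : Chain X 1 ⧸ relBoundaries A) = 0 := hx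
  rw [Submodule.Quotient.mk_eq_zero] at h
  exact (Submodule.Quotient.mk_eq_zero _).2 h

theorem chainMap_id (n : ℕ) (c : Chain X n) : chainMap (ContinuousMap.id X) n c = c := by
  exact Finsupp.mapDomain_id (v := c)

theorem H1.toRel_injective (A : Set X) [DiscreteTopology A] :
    Function.Injective (H1.toRel A) := by
  refine (injective_iff_map_eq_zero _).2 fun x hx => ?_
  obtain ⟨c, rfl⟩ := Submodule.Quotient.mk_surjective _ x
  refine (Submodule.Quotient.mk_eq_zero _).2 ?_
  have h0 : (Submodule.Quotient.mk (relCyclesMap (ContinuousMap.id X) (Set.mapsTo_empty _ _) c) :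
    H1 X A) = 0 := hx
  have h : chainMap (ContinuousMap.id X) 1 (c : Chain X 1) ∈ relBoundaries A := by
    rw [Submodule.Quotient.mk_eq_zero] at h0
    exact h0
  rw [chainMap_id, relBoundaries, sup_eq_left.2 (chainsIn_one_le_range_bd A)] at h
  change (c : Chain X 1) ∈ relBoundaries ∅
  rwa [relBoundaries_empty]

/-- Subtracting a chain of `A` with the same boundary makes the cycle absolute without changing its
relative class. -/
theorem H1.exists_toRel_of_boundary_eq_zero (A : Set X) {x : H1 X A}
    (hx : H1.boundary A x = 0) : ∃ y, H1.toRel A y = x := by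
  obtain ⟨c, rfl⟩ := Submodule.Quotient.mk_surjective _ x
  obtain ⟨v, hv, hvc⟩ := (Submodule.Quotient.mk_eq_zero _).1 hx
  have hvc' : bd X 0 v = bd X 0 (c : Chain X 1) := hvc
  have hcyc : (c : Chain X 1) - v ∈ relCycles (∅ : Set X) := by
    change bd X 0 (c - v) ∈ chainsIn ∅ 0
    rw [map_sub, hvc', sub_self]
    exact zero_mem _
  refine ⟨Submodule.Quotient.mk ⟨_, hcyc⟩, ?_⟩
  refine (Submodule.Quotient.eq _).2 ?_
  change chainMap (ContinuousMap.id X) 1 ((c : Chain X 1) - v) - c ∈ relBoundaries A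
  rw [chainMap_id, sub_sub_cancel_left]
  exact neg_mem (Submodule.mem_sup_right hv)

theorem H1.boundary_toRel (A : Set X) (y : H1 X ∅) : H1.boundary A (H1.toRel A y) = 0 := by
  obtain ⟨c, rfl⟩ := Submodule.Quotient.mk_surjective _ y
  refine (Submodule.Quotient.mk_eq_zero _).2 ?_
  have h : bd X 0 (c : Chain X 1) = 0 := by
    have := c.2
    change bd X 0 (c : Chain X 1) ∈ chainsIn ∅ 0 at this
    rwa [chainsIn_empty] at this
  refine ⟨0, zero_mem _, ?_⟩
  change bd X 0 0 = bd X 0 (chainMap _ 1 (c : Chain X 1))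
  rw [chainMap_bd, h, map_zero, map_zero]

theorem baseChange_injective {M M' : Type*} [AddCommGroup M] [AddCommGroup M']
    {φ : M →ₗ[ℤ] M'} (hφ : Function.Injective φ) :
    Function.Injective (φ.baseChange ℂ) := by
  rw [LinearMap.baseChange_eq_ltensor]
  exact Module.Flat.lTensor_preserves_injective_linearMap φ hφ

/-- A closed relative cycle on a pair with discrete subspace comes from a unique absolute class. -/
theorem existsUnique_toRel_baseChange (A : Set X) [DiscreteTopology A] {γ : ℂ ⊗[ℤ] H1 X A}
    (hγ : (H1.boundary A).baseChange ℂ γ = 0) :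
    ∃ c : ℂ ⊗[ℤ] H1 X ∅, ∀ c', (H1.toRel A).baseChange ℂ c' = γ ↔ c' = c := by
  have hex : Function.Exact (H1.toRel A) (H1.boundary A) := fun x =>
    ⟨H1.exists_toRel_of_boundary_eq_zero A, by
      rintro ⟨y, rfl⟩
      exact H1.boundary_toRel A y⟩
  -- Flatness of `ℂ` over `ℤ` preserves exactness at the relative group.
  have h := Module.Flat.lTensor_exact ℂ hex
  rw [← LinearMap.baseChange_eq_ltensor, ← LinearMap.baseChange_eq_ltensor] at h
  obtain ⟨c, rfl⟩ := (h γ).1 hγ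
  exact ⟨c, fun c' => (baseChange_injective (H1.toRel_injective A)).eq_iff⟩

/-- The class in `H₀(A; ℤ)` of a point. -/
def pointClass (A : Set X) (x : X) (hx : x ∈ A) : H0 A :=
  Submodule.Quotient.mk ⟨Finsupp.single (ContinuousMap.const _ x) 1,
    Finsupp.single_mem_supported ℤ _ fun _ => hx⟩

theorem boundary_pathClass (A : Set X) {a b : X} (p : Path a b) (ha : a ∈ A) (hb : b ∈ A) :
    H1.boundary A (pathClass A p ha hb) = pointClass A b hb - pointClass A a ha := by
  refine congrArg Submodule.Quotient.mk (Subtype.ext ?_)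
  change bd X 0 (Finsupp.single (pathSimplex p) 1) =
    Finsupp.single (ContinuousMap.const _ b) 1 - Finsupp.single (ContinuousMap.const _ a) 1
  have e0 : (pathSimplex p).comp (face 0) = ContinuousMap.const _ b := by
    ext s
    have h : face 0 s 1 = 1 := by
      rw [← stdSimplex.sum_eq_one s]
      simpa using face_apply_succAbove 0 s 0
    simp [pathSimplex, h]
  have e1 : (pathSimplex p).comp (face 1) = ContinuousMap.const _ a := by
    ext s
    have h : face 1 s 1 = 0 := face_apply_self (n := 0) 1 s
    simp [pathSimplex, h]
  rw [bd_single, one_smul, Fin.sum_univ_two, e0, e1, sub_eq_add_neg, ← Finsupp.single_neg]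
  simp

end Homology

/-! ### Cutting the two geodesics at the cusp `∞` -/

noncomputable section Geodesics

open HStar

/-- From `ρ³ + 1 = (ρ + 1)(ρ² - ρ + 1)`, with `ρ ≠ -1`. -/
theorem rho_sq_eq : Complex.exp (Real.pi * Complex.I / 3) ^ 2 =
    Complex.exp (Real.pi * Complex.I / 3) - 1 := by
  have h := rho_cube
  have hne : Complex.exp (Real.pi * Complex.I / 3) + 1 ≠ 0 := by
    intro h0
    have := congrArg Complex.im h0
    have hpos := rho_im_pos
    simp only [Complex.add_im, Complex.one_im, Complex.zero_im] at this
    linarith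
  refine mul_left_cancel₀ hne ?_
  linear_combination h

theorem T_smul_rhoSq : ModularGroup.T • rhoSq = rho := by
  apply UpperHalfPlane.ext
  rw [UpperHalfPlane.modular_T_smul, UpperHalfPlane.coe_vadd]
  simp [rho, rhoSq, rho_sq_eq]

theorem S_smul_rho : ModularGroup.S • rho = rhoSq := by
  apply UpperHalfPlane.ext
  rw [UpperHalfPlane.modular_S_smul, UpperHalfPlane.coe_mk]
  have h0 : Complex.exp (Real.pi * Complex.I / 3) ≠ 0 := Complex.exp_ne_zero _
  have h := rho_cube
  simp only [rho, rhoSq]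
  rw [inv_neg, neg_eq_iff_eq_neg, inv_eq_iff_eq_inv]
  refine eq_inv_of_mul_eq_one_left ?_
  linear_combination -h

theorem S_smul_S_smul (z : ℍ) : ModularGroup.S • ModularGroup.S • z = z := by
  rw [← mul_smul, S_mul_S, ModularGroup.SL_neg_smul, one_smul]

/-- The point `z + max(0, r) i`. -/
def raise (z : ℍ) (r : ℝ) : ℍ :=
  -- The truncation keeps the point in `ℍ` for every real `r`, so the map is total and continuous.
  ⟨z + (max 0 r : ℝ) * Complex.I, by
    have := z.im_pos
    simpa using add_pos_of_pos_of_nonneg this (le_max_left 0 r)⟩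

theorem coe_raise (z : ℍ) {r : ℝ} (hr : 0 ≤ r) : (raise z r : ℂ) = z + r * Complex.I := by
  simp [raise, max_eq_right hr]

theorem lt_im_raise (z : ℍ) (r : ℝ) : r < (raise z r).im := by
  have h : (raise z r).im = z.im + max 0 r := by
    rw [← UpperHalfPlane.coe_im]
    simp [raise]
  rw [h]
  linarith [z.im_pos, le_max_right 0 r]

theorem continuous_raise : Continuous fun x : ℍ × ℝ => raise x.1 x.2 :=
  Continuous.upperHalfPlaneMk (by fun_prop) _

/-- The vertical geodesic from `z` to `∞`, parametrized by `z + 2 i t / (1 - t)`. -/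
def vertFun (z : ℍ) (t : ℝ) : HStar :=
  if t = 1 then cusp OnePoint.infty else pt (raise z (2 * t / (1 - t)))

theorem vertFun_zero (z : ℍ) : vertFun z 0 = pt z := by
  rw [vertFun, if_neg zero_ne_one]
  congr 1
  apply UpperHalfPlane.ext
  rw [coe_raise _ (by simp)]
  simp

/-- Near a point with `t = 1` only the height matters, and it exceeds `2t / (1 - t)` whatever `z`
is. Hence `z` may be discontinuous there, as happens at the apex of a cone. -/
theorem continuous_vertFun {U : Type*} [TopologicalSpace U] {z : U → ℍ} {t : U → ℝ}
    (ht : Continuous t) (h1 : ∀ u, t u ≤ 1)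
    (hz : ∀ u, t u ≠ 1 → ContinuousAt z u) : Continuous fun u => vertFun (z u) (t u) := by
  refine continuous_iff_continuousAt.2 fun u => ?_
  by_cases hu : t u = 1
  · intro V hV
    obtain ⟨W, hWV, hW, huW⟩ := mem_nhds_iff.1 hV
    simp only [vertFun, if_pos hu] at huW
    obtain ⟨B, hB⟩ := hW.2 1 (by rwa [one_smul])
    -- If `(1 - t)(|B| + 2) < 1`, then `B(1 - t) < 2t - 1`, so the height passes `B`.
    have hlt : 1 - 1 / (|B| + 2) < t u := by
      rw [hu]
      have : 0 < 1 / (|B| + 2) := by positivity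
      linarith
    change ∀ᶠ v in nhds u, vertFun (z v) (t v) ∈ V
    filter_upwards [ht.continuousAt.eventually (lt_mem_nhds hlt)] with v hv
    apply hWV
    by_cases hv1 : t v = 1
    · rwa [vertFun, if_pos hv1]
    rw [vertFun, if_neg hv1, ← one_smul SL(2, ℤ) (pt _)]
    apply hB
    refine lt_of_le_of_lt ?_ (lt_im_raise _ _)
    have hlt1 : 0 < 1 - t v := sub_pos.2 (lt_of_le_of_ne (h1 v) hv1)
    have hB2 : 0 < |B| + 2 := by positivity
    have hv' : (1 - t v) * (|B| + 2) < 1 := by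
      rw [← lt_div_iff₀ hB2]; linarith
    rw [le_div_iff₀ hlt1]
    nlinarith [le_abs_self B, abs_nonneg B]
  · have hc : ContinuousAt (fun v => pt (raise (z v) (2 * t v / (1 - t v)))) u := by
      refine continuous_pt.continuousAt.comp (ContinuousAt.comp
        (g := fun x : ℍ × ℝ => raise x.1 x.2) continuous_raise.continuousAt
        ((hz u hu).prodMk ?_))
      exact (ht.const_mul 2).continuousAt.div (continuous_const.sub ht).continuousAt
        (sub_ne_zero.2 (Ne.symm hu))
    refine hc.congr ?_
    filter_upwards [ht.continuousAt.eventually_ne hu] with v hv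
    rw [vertFun, if_neg hv]

/-- The vertical geodesic from `z` to `∞` as a singular simplex. -/
def vert (z : ℍ) : C(stdSimplex ℝ (Fin 2), HStar) :=
  ⟨fun s => vertFun z (s 1), continuous_vertFun (continuous_coord 1)
    (fun s => stdSimplex.le_one s 1) fun _ _ => continuousAt_const⟩

/-- The action of an element of `SL₂(ℤ)` on the extended upper half-plane, as a continuous map. -/
def smulMap (γ : SL(2, ℤ)) : C(HStar, HStar) := ⟨fun w => γ • w, continuous_smul_star γ⟩

theorem smulMap_mul (γ δ : SL(2, ℤ)) : (smulMap γ).comp (smulMap δ) = smulMap (γ * δ) := by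
  ext w
  exact (mul_smul γ δ w).symm

/-- The cone with vertex `∞` over a path in the upper half-plane. -/
theorem cone_mem {a b : ℍ} (p : Path a b) :
    Finsupp.single (pathSimplex (p.map continuous_pt)) 1 + Finsupp.single (vert b) 1 -
      Finsupp.single (vert a) 1 ∈ LinearMap.range (bd HStar 1) := by
  have hsum : ∀ s : stdSimplex ℝ (Fin 3), s 0 + s 1 = 1 - s 2 := fun s => by
    have h := stdSimplex.sum_eq_one s
    rw [Fin.sum_univ_three] at h
    linarith
  -- Coordinates of the cone: the third barycentric coordinate is the height parameter, and the
  -- other two, normalized, give the parameter on `p`. At the apex the quotient is `0 / 0`, which is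
  -- harmless because the value there is the cusp.
  have h := bd_simplex_two ⟨fun s : stdSimplex ℝ (Fin 3) =>
    vertFun (p.extend (s 1 / (s 0 + s 1))) (s 2), continuous_vertFun (continuous_coord 2)
    (fun s => stdSimplex.le_one s 2) fun s hs => by
      refine p.continuous_extend.continuousAt.comp ?_
      refine (continuous_coord 1).continuousAt.div
        ((continuous_coord 0).add (continuous_coord 1)).continuousAt ?_
      rw [hsum, sub_ne_zero]
      exact Ne.symm hs⟩
  convert! h using 1
  rw [add_comm, add_sub_right_comm]
  congr 3
  · refine ContinuousMap.ext fun s => ?_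
    have e0 := face_apply_self 0 s
    have e1 : face 0 s 1 = s 0 := face_apply_succAbove 0 s 0
    have e2 : face 0 s 2 = s 1 := face_apply_succAbove 0 s 1
    simp only [vert, ContinuousMap.comp_apply, ContinuousMap.coe_mk, e0, e1, e2, zero_add]
    -- At the apex the quotient is not `1`, but the base point is irrelevant there.
    by_cases hs : s 0 = 0
    · have h1 : s 1 = 1 := by linarith [stdSimplex.add_eq_one s]
      simp [vertFun, h1]
    · rw [div_self hs, p.extend_one]
  · refine ContinuousMap.ext fun s => ?_
    have e0 : face 1 s 0 = s 0 := face_apply_succAbove 1 s 0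
    have e1 := face_apply_self 1 s
    have e2 : face 1 s 2 = s 1 := face_apply_succAbove 1 s 1
    simp only [vert, ContinuousMap.comp_apply, ContinuousMap.coe_mk, e0, e1, e2, zero_div,
      p.extend_zero]
  · refine ContinuousMap.ext fun s => ?_
    have e0 : face 2 s 0 = s 0 := face_apply_succAbove 2 s 0
    have e1 : face 2 s 1 = s 1 := face_apply_succAbove 2 s 1
    have e2 := face_apply_self 2 s
    simp only [ContinuousMap.comp_apply, ContinuousMap.coe_mk, e0, e1, e2,
      stdSimplex.add_eq_one, div_one, vertFun_zero]
    exact congrArg pt (p.extend_apply ⟨stdSimplex.zero_le s 1, stdSimplex.le_one s 1⟩).symm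

/-- The factor `2` in `vertFun` is chosen for this: from `i`, both parametrizations give `i(1 + t) /
(1 - t)`, so the simplices are equal and not merely homologous. -/
theorem seg_axis_half_one :
    seg ⟨axis.extend, axis.continuous_extend⟩ (1 / 2) 1 = vert (imAxis 1) := by
  refine ContinuousMap.ext fun s => ?_
  have h := stdSimplex.add_eq_one s
  have h0 := stdSimplex.zero_le s 1
  have h1 := stdSimplex.le_one s 1
  have e : s 0 * (1 / 2) + s 1 * 1 = (1 + s 1) / 2 := by linarith
  have hmem : (1 + s 1) / 2 ∈ unitInterval := ⟨by linarith, by linarith⟩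
  simp only [seg, ContinuousMap.comp_apply, ContinuousMap.coe_mk, e, vert]
  rw [axis.extend_apply hmem]
  change axisFun _ = _
  rw [axisFun, if_neg (by simp only; linarith)]
  by_cases hs : s 1 = 1
  · simp [vertFun, hs]
  have hlt : 0 < 1 - s 1 := sub_pos.2 (lt_of_le_of_ne h1 hs)
  rw [if_neg (by simp only; intro h2; apply hs; linarith), vertFun, if_neg hs]
  congr 1
  apply UpperHalfPlane.ext
  rw [coe_raise _ (by positivity), coe_imAxis one_pos, ← add_mul, coe_imAxis]
  · congr 1
    norm_cast
    have h2 : 1 - (1 + s 1) / 2 = (1 - s 1) / 2 := by ring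
    simp only [h2]
    have := hlt.ne'
    field_simp
    ring
  · exact div_pos (by simp only; linarith) (by simp only; linarith)

/-- `S` sends `iy` to `i / y`, which reverses the parameter of the axis about its midpoint. -/
theorem seg_axis_half_zero :
    seg ⟨axis.extend, axis.continuous_extend⟩ (1 / 2) 0 =
      (smulMap ModularGroup.S).comp (vert (imAxis 1)) := by
  rw [← seg_axis_half_one]
  refine ContinuousMap.ext fun s => ?_
  have h := stdSimplex.add_eq_one s
  have h0 := stdSimplex.zero_le s 1
  have h1 := stdSimplex.le_one s 1
  have e : s 0 * (1 / 2) + s 1 * 1 = (1 + s 1) / 2 := by linarith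
  have e' : s 0 * (1 / 2) + s 1 * 0 = (1 - s 1) / 2 := by linarith
  have hmem : (1 + s 1) / 2 ∈ unitInterval := ⟨by linarith, by linarith⟩
  have hmem' : (1 - s 1) / 2 ∈ unitInterval := ⟨by linarith, by linarith⟩
  simp only [seg, ContinuousMap.comp_apply, ContinuousMap.coe_mk, e, e', smulMap]
  rw [axis.extend_apply hmem, axis.extend_apply hmem']
  change axisFun _ = ModularGroup.S • axisFun _
  have h2 : ¬((1 + s 1) / 2 = 0) := by linarith
  simp only [axisFun, if_neg h2]
  by_cases hs : s 1 = 1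
  · simp [hs, S_smul_cusp]
  have hlt : 0 < 1 - s 1 := sub_pos.2 (lt_of_le_of_ne h1 hs)
  rw [if_neg (by linarith), if_neg (by linarith), if_neg (by intro h2; apply hs; linarith),
    smul_pt, ← S_smul_imAxis]
  · congr 3
    rw [inv_div]
    congr 1
    · ring
    · ring
  · exact div_pos (by linarith) (by linarith)

theorem axis_mem :
    Finsupp.single (pathSimplex axis) 1 - Finsupp.single (vert (imAxis 1)) 1 +
      Finsupp.single ((smulMap ModularGroup.S).comp (vert (imAxis 1))) 1 ∈
      LinearMap.range (bd HStar 1) := by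
  have h := add_mem (seg_add_seg ⟨axis.extend, axis.continuous_extend⟩ (1 / 2) 0 1)
    (zero_mem (LinearMap.range (bd HStar 1)))
  rw [seg_axis_half_one, seg_axis_half_zero, ← pathSimplex_eq_seg, add_zero] at h
  exact h

theorem smulMap_T_comp_vert (z : ℍ) :
    (smulMap ModularGroup.T).comp (vert z) = vert (ModularGroup.T • z) := by
  refine ContinuousMap.ext fun s => ?_
  change ModularGroup.T • vertFun z (s 1) = vertFun _ (s 1)
  by_cases hs : s 1 = 1
  · rw [vertFun, vertFun, if_pos hs, if_pos hs, smul_cusp, OnePoint.smul_infty_eq_ite]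
    simp [ModularGroup.coe_T]
  · rw [vertFun, vertFun, if_neg hs, if_neg hs, smul_pt]
    congr 1
    apply UpperHalfPlane.ext
    rw [UpperHalfPlane.modular_T_smul, UpperHalfPlane.coe_vadd, UpperHalfPlane.modular_T_smul]
    simp only [raise, UpperHalfPlane.coe_vadd]
    ring

theorem vert_rhoSq : vert rhoSq = (smulMap ModularGroup.T⁻¹).comp (vert rho) := by
  rw [← T_smul_rhoSq, ← smulMap_T_comp_vert, ← ContinuousMap.comp_assoc, smulMap_mul,
    inv_mul_cancel]
  refine ContinuousMap.ext fun s => ?_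
  exact (one_smul SL(2, ℤ) _).symm

/-- The arc from `ρ` to `ρ²` is homologous to the path through `∞`. -/
theorem arc_sub_vert_mem :
    Finsupp.single (pathSimplex (arc.map continuous_pt)) 1 +
      Finsupp.single ((smulMap ModularGroup.T⁻¹).comp (vert rho)) 1 -
      Finsupp.single (vert rho) 1 ∈ LinearMap.range (bd HStar 1) := by
  rw [← vert_rhoSq]
  exact cone_mem arc

/-- The imaginary axis is homologous to the path from `0` to `∞` through `ρ`. -/
theorem axis_sub_vert_mem :
    Finsupp.single (pathSimplex axis) 1 - Finsupp.single (vert rho) 1 +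
      Finsupp.single ((smulMap tau).comp (vert rho)) 1 ∈ LinearMap.range (bd HStar 1) := by
  -- Any path from `i` to `ρ` will do. One cone is taken over `p`, and the other is the image under
  -- `S` of the cone over `Sp`. As `S` is an involution on `ℍ` fixing `i`, the copies of `p` and the
  -- verticals at `i` cancel, leaving the vertical at `ρ` and its image under `ST⁻¹ = τ`.
  have p : Path (imAxis 1) rho := PathConnectedSpace.somePath _ _
  have h1 := cone_mem p
  have h2 := chainMap_range_bd (smulMap ModularGroup.S)
    (cone_mem (p.map (continuous_smul_upper ModularGroup.S)))
  have hi : ModularGroup.S • imAxis 1 = imAxis 1 := by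
    simpa using S_smul_imAxis one_pos
  have hp : (smulMap ModularGroup.S).comp
      (pathSimplex ((p.map (continuous_smul_upper ModularGroup.S)).map continuous_pt)) =
      pathSimplex (p.map continuous_pt) := by
    refine ContinuousMap.ext fun s => ?_
    exact congrArg pt (S_smul_S_smul _)
  have hv : (smulMap ModularGroup.S).comp (vert (ModularGroup.S • rho)) =
      (smulMap tau).comp (vert rho) := by
    rw [S_smul_rho, vert_rhoSq, ← ContinuousMap.comp_assoc, smulMap_mul, tau_eq]
  simp only [map_sub, map_add, chainMap, Finsupp.lmapDomain_apply, Finsupp.mapDomain_single,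
    hp, hv] at h2
  rw [hi] at h2
  have h := add_mem (sub_mem axis_mem h1) h2
  convert! h using 1
  abel

end Geodesics

/-! ### The set `E_N`, cosets of `Γ₁(N)`, and discreteness of the elliptic points -/

noncomputable section Symbols

open HStar

theorem E.ext {N : ℕ} {x y : E N} (h : ∀ j, x.1 j = y.1 j) : x = y := Subtype.ext (funext h)

variable {N : ℕ} [NeZero N]

theorem E.act_one (x : E N) : x.act 1 = x := by
  apply Subtype.ext
  simp [E.act]

theorem E.act_mul (x : E N) (h k : SL(2, ℤ)) : x.act (h * k) = (x.act h).act k := by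
  apply Subtype.ext
  simp only [E.act, Matrix.vecMul_vecMul]
  congr 1
  rw [Matrix.SpecialLinearGroup.coe_mul]
  exact Matrix.map_mul (f := Int.castRingHom (ZMod N))

/-- The permutation of `E_N` given by an element of `SL₂(ℤ)`. -/
def E.actEquiv (h : SL(2, ℤ)) : E N ≃ E N where
  toFun x := x.act h
  invFun x := x.act h⁻¹
  left_inv x := by beta_reduce; rw [← E.act_mul, mul_inv_cancel, E.act_one]
  right_inv x := by beta_reduce; rw [← E.act_mul, inv_mul_cancel, E.act_one]

theorem E.sum_act {M : Type*} [AddCommMonoid M] (F : E N → M) (h : SL(2, ℤ)) :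
    ∑ x : E N, F (x.act h) = ∑ x, F x :=
  (E.actEquiv h).sum_comp F

theorem E.conj_conj (x : E N) : x.conj.conj = x := by
  apply E.ext
  intro j
  fin_cases j <;> simp [E.conj]

theorem E.sum_conj {M : Type*} [AddCommMonoid M] (F : E N → M) :
    ∑ x : E N, F x.conj = ∑ x, F x :=
  Equiv.sum_comp (⟨E.conj, E.conj, E.conj_conj, E.conj_conj⟩ : E N ≃ E N) F

/-- `xᶜ` is `x` times `diag(-1, 1)`, and `twist` is conjugation by that matrix. -/
theorem E.conj_act (x : E N) (h : SL(2, ℤ)) : (x.act h).conj = x.conj.act (twist h) := by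
  apply E.ext
  intro j
  fin_cases j <;> simp [E.conj, E.act, twist, Matrix.vecMul, dotProduct, Fin.sum_univ_two]
  ring

/-- The bottom row of a matrix modulo `N`. -/
def rowOf (γ : SL(2, ℤ)) : E N :=
  ⟨fun j => ((γ 1 j : ℤ) : ZMod N), (gcd_eq_one_iff _ _).2 ⟨-(γ 0 1 : ℤ), (γ 0 0 : ℤ), by
    have h := γ.det_coe
    rw [Matrix.det_fin_two] at h
    have h2 := congrArg (Int.cast : ℤ → ZMod N) h
    push_cast at h2
    linear_combination h2⟩⟩

theorem rowOf_mul (γ h : SL(2, ℤ)) : rowOf (N := N) (γ * h) = (rowOf γ).act h := by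
  apply E.ext
  intro j
  simp [rowOf, E.act, Matrix.vecMul, dotProduct, Fin.sum_univ_two, Matrix.mul_apply]

theorem rowOf_twist (γ : SL(2, ℤ)) : rowOf (N := N) (twist γ) = (rowOf γ).conj := by
  apply E.ext
  intro j
  fin_cases j <;> simp [rowOf, E.conj, twist]

theorem IsLift.rowOf_eq {g : E N → SL(2, ℤ)} (hg : IsLift g) (x : E N) : rowOf (g x) = x :=
  E.ext (hg x)

/-- Two matrices with the same bottom row modulo `N` differ by an element of `Γ₁(N)`. -/
theorem exists_eq_mul_of_rowOf_eq {γ γ' : SL(2, ℤ)} (h : rowOf (N := N) γ = rowOf γ') :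
    ∃ δ ∈ CongruenceSubgroup.Gamma1 N, γ' = δ * γ := by
  refine ⟨γ' * γ⁻¹, ?_, by simp⟩
  have h0 : ((γ 1 0 : ℤ) : ZMod N) = (γ' 1 0 : ℤ) := congrFun (congrArg Subtype.val h) 0
  have h1 : ((γ 1 1 : ℤ) : ZMod N) = (γ' 1 1 : ℤ) := congrFun (congrArg Subtype.val h) 1
  have hd := γ.det_coe
  rw [Matrix.det_fin_two] at hd
  have hd2 := congrArg (Int.cast : ℤ → ZMod N) hd
  have hd' := γ'.det_coe
  rw [Matrix.det_fin_two] at hd'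
  have hd2' := congrArg (Int.cast : ℤ → ZMod N) hd'
  push_cast at hd2 hd2'
  rw [CongruenceSubgroup.Gamma1_mem]
  simp only [Matrix.SpecialLinearGroup.coe_mul, Matrix.SpecialLinearGroup.coe_inv,
    Matrix.adjugate_fin_two, Matrix.mul_apply, Fin.sum_univ_two]
  simp
  refine ⟨?_, ?_, ?_⟩
  · rw [h0, h1]; linear_combination hd2'
  · rw [← h0, ← h1]; linear_combination hd2
  · rw [h0, h1]; ring

/-- A function on `SL₂(ℤ)` is left invariant under `Γ₁(N)`. -/
def LeftInvariant (N : ℕ) {M : Type*} (Φ : SL(2, ℤ) → M) : Prop :=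
  ∀ δ ∈ CongruenceSubgroup.Gamma1 N, ∀ γ, Φ (δ * γ) = Φ γ

theorem LeftInvariant.eq_of_rowOf_eq {M : Type*} {Φ : SL(2, ℤ) → M} (hΦ : LeftInvariant N Φ)
    {γ γ' : SL(2, ℤ)} (h : rowOf (N := N) γ = rowOf γ') : Φ γ = Φ γ' := by
  obtain ⟨δ, hδ, rfl⟩ := exists_eq_mul_of_rowOf_eq h
  exact (hΦ δ hδ γ).symm

/-- The chosen lift of `xh` need not be `g_x h`, but they have the same bottom row modulo `N`, so an
invariant function does not see the choice. -/
theorem LeftInvariant.lift_act {M : Type*} {Φ : SL(2, ℤ) → M} (hΦ : LeftInvariant N Φ)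
    {g : E N → SL(2, ℤ)} (hg : IsLift g) (x : E N) (h : SL(2, ℤ)) : Φ (g (x.act h)) = Φ (g x * h) :=
  hΦ.eq_of_rowOf_eq (by rw [rowOf_mul, hg.rowOf_eq, hg.rowOf_eq])

theorem LeftInvariant.lift_conj {M : Type*} {Φ : SL(2, ℤ) → M} (hΦ : LeftInvariant N Φ)
    {g : E N → SL(2, ℤ)} (hg : IsLift g) (x : E N) : Φ (g x.conj) = Φ (twist (g x)) :=
  hΦ.eq_of_rowOf_eq (by rw [rowOf_twist, hg.rowOf_eq, hg.rowOf_eq])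

theorem projY_mul {N : ℕ} {δ : SL(2, ℤ)} (hδ : δ ∈ CongruenceSubgroup.Gamma1 N) (z : ℍ) :
    projY N (δ • z) = projY N z :=
  Quotient.sound ⟨⟨δ, hδ⟩, rfl⟩

theorem projX_mul {N : ℕ} {δ : SL(2, ℤ)} (hδ : δ ∈ CongruenceSubgroup.Gamma1 N) (w : HStar) :
    projX N (δ • w) = projX N w :=
  Quotient.sound ⟨⟨δ, hδ⟩, rfl⟩

theorem properlyDiscontinuousSMul_upper : ProperlyDiscontinuousSMul SL(2, ℤ) ℍ where
  finite_disjoint_inter_image {K L} hK hL := by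
    have h := (properlyDiscontinuousSL2ZRange.finite_disjoint_inter_image hK hL)
    refine Set.Finite.of_finite_image (f := fun γ : SL(2, ℤ) =>
      (⟨Matrix.SpecialLinearGroup.mapGL ℝ γ, γ, rfl⟩ :
        (Matrix.SpecialLinearGroup.mapGL ℝ : SL(2, ℤ) →* GL (Fin 2) ℝ).range)) (h.subset ?_) ?_
    · rintro _ ⟨γ, hγ, rfl⟩
      exact hγ
    · intro γ _ γ' _ hγ
      exact Matrix.SpecialLinearGroup.mapGL_injective (congrArg Subtype.val hγ)

theorem t2Space_Y1 (N : ℕ) : T2Space (Y1 N) := by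
  have h1 := properlyDiscontinuousSMul_upper
  have h2 : ContinuousConstSMul SL(2, ℤ) ℍ := ⟨continuous_smul_upper⟩
  have h3 : ContinuousConstSMul (CongruenceSubgroup.Gamma1 N) ℍ :=
    ⟨fun γ => continuous_smul_upper γ⟩
  exact t2Space_of_properlyDiscontinuousSMul_of_t2Space

/-- Since `ρ² = Sρ`, only the points `γρ` occur, and their images depend only on the row of `γ` in
the finite set `E_N`. -/
theorem finite_rhoPoints {g : E N → SL(2, ℤ)} (hg : IsLift g) : (rhoPoints N).Finite := by
  refine (Set.finite_range fun x : E N => projY N (g x • rho)).subset ?_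
  have hinv : LeftInvariant N fun γ => projY N (γ • rho) := fun δ hδ γ => by
    simp only [mul_smul]
    exact projY_mul hδ _
  have key : ∀ γ : SL(2, ℤ), projY N (γ • rho) ∈ Set.range fun x : E N => projY N (g x • rho) :=
    fun γ => ⟨rowOf γ, hinv.eq_of_rowOf_eq (hg.rowOf_eq _)⟩
  rintro _ ⟨γ, rfl | rfl⟩
  · exact key γ
  · rw [← S_smul_rho, ← mul_smul]
    exact key _

theorem discreteTopology_rhoPoints {g : E N → SL(2, ℤ)} (hg : IsLift g) :
    DiscreteTopology (rhoPoints N) := by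
  have := t2Space_Y1 N
  have := (finite_rhoPoints hg).to_subtype
  infer_instance

end Symbols

/-! ### The symbols in terms of vertical geodesics, and the comparison of coefficients -/

noncomputable section Cycles

open HStar

section General

variable {X Y : Type*} [TopologicalSpace X] [TopologicalSpace Y]

theorem pathClass_congr (A : Set X) {a b a' b' : X} {p : Path a b} {p' : Path a' b'} (ha : a ∈ A)
    (hb : b ∈ A) (ha' : a' ∈ A) (hb' : b' ∈ A) (h : ∀ t, p t = p' t) :
    pathClass A p ha hb = pathClass A p' ha' hb' := by
  refine congrArg Submodule.Quotient.mk (Subtype.ext ?_)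
  exact congrArg (fun σ => Finsupp.single σ (1 : ℤ)) (ContinuousMap.ext fun s => h _)

theorem pointClass_congr (A : Set X) {x y : X} (hx : x ∈ A) (hy : y ∈ A) (h : x = y) :
    pointClass A x hx = pointClass A y hy := by
  subst h; rfl

/-- The map from the relative homology of a pair with discrete subspace to the quotient of the
chains by the relative boundaries of another pair. -/
def H1.mapChainQuot (f : C(X, Y)) (A : Set X) [DiscreteTopology A] (B : Set Y) :
    H1 X A →ₗ[ℤ] Chain Y 1 ⧸ relBoundaries B :=
  Submodule.mapQ _ _ ((chainMap f 1).comp (relCycles A).subtype) fun c hc => by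
    have h : (c : Chain X 1) ∈ relBoundaries A := hc
    -- Because `A` is discrete its 1-chains are already boundaries, so `f` need not send `A` into
    -- `B`.
    rw [relBoundaries, sup_eq_left.2 (chainsIn_one_le_range_bd A)] at h
    exact Submodule.mem_sup_left (chainMap_range_bd f h)

/-- The image of an absolute class can be computed from any relative cycle it represents, without
constructing the absolute lift. -/
theorem H1.mapChainQuot_toRel (f : C(X, Y)) (A : Set X) [DiscreteTopology A] (B : Set Y)
    (y : H1 X ∅) :
    H1.mapChainQuot f A B (H1.toRel A y) = H1.toChainQuot B (H1.toRel B (H1.push f y)) := by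
  obtain ⟨c, rfl⟩ := Submodule.Quotient.mk_surjective _ y
  change (Submodule.Quotient.mk (chainMap f 1 (chainMap (ContinuousMap.id X) 1 (c : Chain X 1))) :
      Chain Y 1 ⧸ relBoundaries B) =
    Submodule.Quotient.mk (chainMap (ContinuousMap.id Y) 1 (chainMap f 1 (c : Chain X 1)))
  rw [chainMap_id, chainMap_id]

end General

variable {N : ℕ}

/-- The class of the image in `X₁(N)(ℂ)` of the geodesic from `γρ` to `γ∞`. -/
def vertClass (N : ℕ) (γ : SL(2, ℤ)) : Chain (X1 N) 1 ⧸ relBoundaries (cusps N) :=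
  Submodule.Quotient.mk
    (Finsupp.single ((projX N).comp ((smulMap γ).comp (vert rho))) 1)

theorem leftInvariant_vertClass : LeftInvariant N (vertClass N) := fun δ hδ γ => by
  rw [vertClass, vertClass, ← smulMap_mul]
  congr 2
  refine ContinuousMap.ext fun s => ?_
  exact projX_mul hδ _

theorem leftInvariant_rhoSymbol : LeftInvariant N (rhoSymbol N) := fun δ hδ γ =>
  pathClass_congr _ _ _ _ _ fun t =>
    (congrArg (projY N) (mul_smul δ γ (arc t))).trans (projY_mul hδ _)

theorem mk_chainMap_eq_zero (γ : SL(2, ℤ)) {c : Chain HStar 1}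
    (hc : c ∈ LinearMap.range (bd HStar 1)) :
    (Submodule.Quotient.mk (chainMap ((projX N).comp (smulMap γ)) 1 c) :
      Chain (X1 N) 1 ⧸ relBoundaries (cusps N)) = 0 := by
  rw [Submodule.Quotient.mk_eq_zero]
  exact Submodule.mem_sup_left (chainMap_range_bd _ hc)

theorem mk_comp_smulMap_vert (γ δ : SL(2, ℤ)) :
    (Submodule.Quotient.mk (Finsupp.single
      (((projX N).comp (smulMap γ)).comp ((smulMap δ).comp (vert rho))) 1) :
      Chain (X1 N) 1 ⧸ relBoundaries (cusps N)) = vertClass N (γ * δ) := by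
  rw [vertClass, ← smulMap_mul]
  rfl

theorem toChainQuot_cuspSymbol (γ : SL(2, ℤ)) :
    H1.toChainQuot (cusps N) (cuspSymbol N γ) = vertClass N γ - vertClass N (γ * tau) := by
  have h := mk_chainMap_eq_zero (N := N) γ axis_sub_vert_mem
  simp only [map_sub, map_add, chainMap, Finsupp.lmapDomain_apply, Finsupp.mapDomain_single,
    Submodule.Quotient.mk_add, Submodule.Quotient.mk_sub, mk_comp_smulMap_vert] at h
  have e : H1.toChainQuot (cusps N) (cuspSymbol N γ) =
    Submodule.Quotient.mk (Finsupp.single (((projX N).comp (smulMap γ)).comp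
      (pathSimplex axis)) 1) := rfl
  have e' : (Submodule.Quotient.mk (Finsupp.single (((projX N).comp (smulMap γ)).comp
      (vert rho)) 1) : Chain (X1 N) 1 ⧸ relBoundaries (cusps N)) = vertClass N γ := rfl
  rw [← e, e'] at h
  rw [← sub_eq_zero, ← h]
  abel

theorem mapChainQuot_rhoSymbol [DiscreteTopology (rhoPoints N)] (γ : SL(2, ℤ)) :
    H1.mapChainQuot (inclYX N) (rhoPoints N) (cusps N) (rhoSymbol N γ) =
      vertClass N γ - vertClass N (γ * ModularGroup.T⁻¹) := by
  have h := mk_chainMap_eq_zero (N := N) γ arc_sub_vert_mem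
  simp only [map_sub, map_add, chainMap, Finsupp.lmapDomain_apply, Finsupp.mapDomain_single,
    Submodule.Quotient.mk_add, Submodule.Quotient.mk_sub, mk_comp_smulMap_vert] at h
  have e : H1.mapChainQuot (inclYX N) (rhoPoints N) (cusps N) (rhoSymbol N γ) =
    Submodule.Quotient.mk (Finsupp.single (((projX N).comp (smulMap γ)).comp
      (pathSimplex (arc.map continuous_pt))) 1) := by
    change Submodule.Quotient.mk (chainMap (inclYX N) 1 (Finsupp.single _ 1)) = _
    rw [chainMap, Finsupp.lmapDomain_apply, Finsupp.mapDomain_single]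
    rfl
  have e' : (Submodule.Quotient.mk (Finsupp.single (((projX N).comp (smulMap γ)).comp
      (vert rho)) 1) : Chain (X1 N) 1 ⧸ relBoundaries (cusps N)) = vertClass N γ := rfl
  rw [← e, e'] at h
  rw [← sub_eq_zero, ← h]
  abel

/-- The class in `H₀` of the image of `γρ`. -/
def rhoPoint (N : ℕ) (γ : SL(2, ℤ)) : H0 (rhoPoints N) :=
  pointClass (rhoPoints N) (projY N (γ • rho)) ⟨γ, Or.inl rfl⟩

theorem leftInvariant_rhoPoint : LeftInvariant N (rhoPoint N) := fun δ hδ γ =>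
  pointClass_congr _ _ _ ((congrArg (projY N) (mul_smul δ γ rho)).trans (projY_mul hδ _))

theorem tau_smul_rho : tau • rho = rho := by
  rw [tau_eq, mul_smul]
  nth_rw 1 [← T_smul_rhoSq]
  rw [inv_smul_smul, ← S_smul_rho, S_smul_S_smul]

theorem rhoPoint_mul_tau (γ : SL(2, ℤ)) : rhoPoint N (γ * tau) = rhoPoint N γ :=
  pointClass_congr _ _ _ (by rw [mul_smul, tau_smul_rho])

theorem boundary_rhoSymbol (γ : SL(2, ℤ)) :
    H1.boundary (rhoPoints N) (rhoSymbol N γ) =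
      rhoPoint N (γ * ModularGroup.S) - rhoPoint N γ := by
  refine (boundary_pathClass _ _ _ _).trans ?_
  congr 1
  exact pointClass_congr _ _ _ (congrArg (projY N) (by rw [mul_smul, S_smul_rho]))

/-- On the unit circle `z ↦ -z̄` sends the angle `θ` to `π - θ`, which swaps `π/3` and `2π/3`. -/
theorem conjH_arc (t : unitInterval) : conjH (arc t) = arc (unitInterval.symm t) := by
  apply UpperHalfPlane.ext
  change -(starRingEnd ℂ) (Complex.exp _) = Complex.exp _
  rw [← Complex.exp_conj, ← neg_one_mul, ← Complex.exp_pi_mul_I, ← Complex.exp_add]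
  congr 1
  simp only [map_mul, map_div₀, map_add, map_one, Complex.conj_ofReal, Complex.conj_I,
    map_ofNat, unitInterval.coe_symm_eq]
  push_cast
  ring

theorem conj_rhoSymbol (γ : SL(2, ℤ)) :
    H1.map (conjY N) (conjY_mapsTo N) (rhoSymbol N γ) = -rhoSymbol N (twist γ) := by
  rw [eq_neg_iff_add_eq_zero]
  refine (Submodule.Quotient.mk_eq_zero _).2 ?_
  change chainMap (conjY N) 1 (Finsupp.single _ 1) + Finsupp.single _ 1 ∈ relBoundaries _
  refine Submodule.mem_sup_left ?_
  have h := pathSimplex_add_symm_mem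
    ((arc.map (continuous_smul_upper (twist γ))).map (projY N).continuous).symm
  rw [Path.symm_symm] at h
  rw [chainMap, Finsupp.lmapDomain_apply, Finsupp.mapDomain_single]
  convert! h using 3
  refine ContinuousMap.ext fun s => ?_
  refine congrArg (projY N) ((conjH_smul γ _).trans ?_)
  exact congrArg (twist γ • ·) (conjH_arc _)

variable [NeZero N]

/-- The Manin relations for a function on `E_N`. -/
structure IsManin (φ : E N → ℂ) : Prop where
  act_S : ∀ x, φ (x.act ModularGroup.S) = -φ x
  act_tau : ∀ x, φ x + φ (x.act tau) + φ (x.act (tau * tau)) = 0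

theorem isManin_xiForm {g : E N → SL(2, ℤ)} (hg : IsLift g)
    (f : CuspForm (CongruenceSubgroup.Gamma1 N) 2) : IsManin (xiForm g f) := by
  have hinv : LeftInvariant N (period f) := fun δ hδ γ => period_mul_left f hδ γ
  constructor
  · intro x
    rw [xiForm, hinv.lift_act hg, (period_manin f _).1, xiForm]
  · intro x
    rw [xiForm, xiForm, xiForm, hinv.lift_act hg, hinv.lift_act hg, (period_manin f _).2]

theorem IsManin.act_S_inv {φ : E N → ℂ} (hφ : IsManin φ) (x : E N) :
    φ (x.act ModularGroup.S⁻¹) = -φ x := by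
  have h := hφ.act_S (x.act ModularGroup.S⁻¹)
  rw [← E.act_mul, inv_mul_cancel, E.act_one] at h
  rw [h, neg_neg]

/-- `twist` inverts `S`, and it exchanges `τ` and `τ²` up to conjugation by `S`. The three-term
relation for `xᶜ` is thus, up to sign, the one for `φ` at `xᶜS`. -/
theorem IsManin.conj {φ : E N → ℂ} (hφ : IsManin φ) : IsManin fun x : E N => φ x.conj := by
  have hS : twist ModularGroup.S = ModularGroup.S⁻¹ := by
    rw [eq_inv_iff_mul_eq_one]; decide
  have h1 : twist tau = ModularGroup.S * (tau * tau) * ModularGroup.S⁻¹ := by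
    rw [eq_mul_inv_iff_mul_eq]; decide
  have h2 : twist (tau * tau) = ModularGroup.S * tau * ModularGroup.S⁻¹ := by
    rw [eq_mul_inv_iff_mul_eq]; decide
  constructor
  · intro x
    rw [E.conj_act, hS, hφ.act_S_inv]
  · intro x
    have h := hφ.act_tau (x.conj.act ModularGroup.S)
    rw [E.conj_act, E.conj_act, h1, h2, E.act_mul, E.act_mul _ _ ModularGroup.S⁻¹, hφ.act_S_inv,
      hφ.act_S_inv, E.act_mul _ _ (tau * tau), E.act_mul _ ModularGroup.S tau]
    rw [hφ.act_S] at h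
    linear_combination -h

theorem isManin_xiFormPlus {g : E N → SL(2, ℤ)} (hg : IsLift g)
    (f : CuspForm (CongruenceSubgroup.Gamma1 N) 2) : IsManin (xiFormPlus g f) := by
  have h := isManin_xiForm hg f
  constructor
  · intro x
    have h1 := h.act_S x
    have h2 := h.conj.act_S x
    simp only [xiFormPlus]
    linear_combination (1 / 2 : ℂ) * h1 + (1 / 2 : ℂ) * h2
  · intro x
    have h1 := h.act_tau x
    have h2 := h.conj.act_tau x
    simp only [xiFormPlus]
    linear_combination (1 / 2 : ℂ) * h1 + (1 / 2 : ℂ) * h2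

theorem sum_tmul_act {M : Type*} [AddCommGroup M] (φ : E N → ℂ) (F : E N → M) (h : SL(2, ℤ)) :
    ∑ x : E N, φ x ⊗ₜ[ℤ] F (x.act h) = ∑ x : E N, φ (x.act h⁻¹) ⊗ₜ[ℤ] F x := by
  rw [← E.sum_act (fun x : E N => φ (x.act h⁻¹) ⊗ₜ[ℤ] F x) h]
  refine Finset.sum_congr rfl fun x _ => ?_
  rw [← E.act_mul, mul_inv_cancel, E.act_one]

/-- The relative cycle `∑ₓ φ(x) {g_x ρ, g_x ρ²}`. -/
def rhoCycle (g : E N → SL(2, ℤ)) (φ : E N → ℂ) : ℂ ⊗[ℤ] H1 (Y1 N) (rhoPoints N) :=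
  ∑ x : E N, φ x ⊗ₜ[ℤ] rhoSymbol N (g x)

theorem IsManin.isClosedCycle {φ : E N → ℂ} (hφ : IsManin φ) {g : E N → SL(2, ℤ)}
    (hg : IsLift g) : IsClosedCycle (rhoCycle g φ) := by
  set F : E N → H0 (rhoPoints N) := fun x => rhoPoint N (g x)
  have hS : ∀ x, rhoPoint N (g x * ModularGroup.S) = F (x.act ModularGroup.S) := fun x =>
    (leftInvariant_rhoPoint.lift_act hg x _).symm
  have hT : ∀ x : E N, F (x.act tau) = F x := fun x =>
    (leftInvariant_rhoPoint.lift_act hg x _).trans (rhoPoint_mul_tau _)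
  have hT2 : ∀ x : E N, F (x.act (tau * tau)) = F x := fun x => by
    rw [E.act_mul, hT, hT]
  -- The point `g_x ρ` does not change under `τ`, so summing the three-term relation against it
  -- counts the same sum three times.
  have h0 : (3 : ℂ) • ∑ x : E N, φ x ⊗ₜ[ℤ] F x = 0 := by
    have h1 := E.sum_act (fun x : E N => φ x ⊗ₜ[ℤ] F x) tau
    have h2 := E.sum_act (fun x : E N => φ x ⊗ₜ[ℤ] F x) (tau * tau)
    simp only [hT, hT2] at h1 h2
    have h3 : ∑ x : E N, (φ x + φ (x.act tau) + φ (x.act (tau * tau))) ⊗ₜ[ℤ] F x = 0 :=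
      Finset.sum_eq_zero fun x _ => by rw [hφ.act_tau, TensorProduct.zero_tmul]
    simp only [TensorProduct.add_tmul, Finset.sum_add_distrib, h1, h2] at h3
    rw [← h3]
    module
  have h0' : ∑ x : E N, φ x ⊗ₜ[ℤ] F x = 0 := (smul_eq_zero_iff_right three_ne_zero).1 h0
  rw [IsClosedCycle, rhoCycle, map_sum]
  simp only [LinearMap.baseChange_tmul, boundary_rhoSymbol, hS, TensorProduct.tmul_sub,
    Finset.sum_sub_distrib]
  rw [sum_tmul_act]
  simp only [hφ.act_S_inv, TensorProduct.neg_tmul, Finset.sum_neg_distrib]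
  change -(∑ x : E N, φ x ⊗ₜ[ℤ] F x) - ∑ x : E N, φ x ⊗ₜ[ℤ] F x = 0
  rw [h0', neg_zero, sub_zero]

theorem IsManin.mapChainQuot_rhoCycle [DiscreteTopology (rhoPoints N)] {φ : E N → ℂ}
    (hφ : IsManin φ) {g : E N → SL(2, ℤ)} (hg : IsLift g) :
    (H1.mapChainQuot (inclYX N) (rhoPoints N) (cusps N)).baseChange ℂ (rhoCycle g φ) =
      (H1.toChainQuot (cusps N)).baseChange ℂ (symbolSum g φ) := by
  set F : E N → Chain (X1 N) 1 ⧸ relBoundaries (cusps N) := fun x => vertClass N (g x)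
  have hact : ∀ (x : E N) h, vertClass N (g x * h) = F (x.act h) := fun x h =>
    (leftInvariant_vertClass.lift_act hg x _).symm
  have htau : tau⁻¹ = tau * tau := inv_eq_of_mul_eq_one_left tau_cube
  -- This uses `T = τ²S`, so the translation enters only through the Manin relations.
  have hT : ∀ x : E N, φ (x.act ModularGroup.T) = -φ (x.act (tau * tau)) := fun x => by
    rw [← tau_mul_tau_mul_S, E.act_mul _ (tau * tau), hφ.act_S]
  rw [rhoCycle, symbolSum, map_sum, map_smul, map_sum]
  simp only [LinearMap.baseChange_tmul, mapChainQuot_rhoSymbol, toChainQuot_cuspSymbol, hact,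
    TensorProduct.tmul_sub, Finset.sum_sub_distrib]
  rw [sum_tmul_act, sum_tmul_act (fun x => φ x + 2 * φ (x.act tau)), inv_inv, htau,
    ← Finset.sum_sub_distrib, ← Finset.sum_sub_distrib, Finset.smul_sum]
  refine Finset.sum_congr rfl fun x _ => ?_
  change φ x ⊗ₜ[ℤ] F x - φ (x.act ModularGroup.T) ⊗ₜ[ℤ] F x = -(1 / 3 : ℂ) •
    ((φ x + 2 * φ (x.act tau)) ⊗ₜ[ℤ] F x -
      (φ (x.act (tau * tau)) + 2 * φ ((x.act (tau * tau)).act tau)) ⊗ₜ[ℤ] F x)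
  rw [← E.act_mul, tau_cube, E.act_one, hT, ← TensorProduct.sub_tmul, ← TensorProduct.sub_tmul,
    TensorProduct.smul_tmul', smul_eq_mul]
  congr 1
  -- The coefficients to compare are `φ(x) + φ(xτ²)` and `-(1/3)(-φ(x) + 2φ(xτ) - φ(xτ²))`; they
  -- differ by two thirds of the three-term sum.
  linear_combination (2 / 3 : ℂ) * hφ.act_tau x

/-- A Manin function defines a closed cycle whose image in `X₁(N)(ℂ)` is a combination of
Manin symbols. -/
theorem IsManin.exists_isImageInX {φ : E N → ℂ} (hφ : IsManin φ) {g : E N → SL(2, ℤ)}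
    (hg : IsLift g) :
    IsClosedCycle (rhoCycle g φ) ∧ ∃ δ : ℂ ⊗[ℤ] H1 (X1 N) ∅,
      IsImageInX (rhoCycle g φ) δ ∧
      (H1.toRel (cusps N)).baseChange ℂ δ = symbolSum g φ := by
  have := discreteTopology_rhoPoints hg
  have hcl := hφ.isClosedCycle hg
  obtain ⟨c, hc⟩ := existsUnique_toRel_baseChange (rhoPoints N) hcl
  refine ⟨hcl, _, ⟨c, hc, rfl⟩, ?_⟩
  apply baseChange_injective (H1.toChainQuot_injective (cusps N))
  rw [← hφ.mapChainQuot_rhoCycle hg, ← (hc c).2 rfl]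
  have hcomp : (H1.toChainQuot (cusps N)) ∘ₗ (H1.toRel (cusps N)) ∘ₗ (H1.push (inclYX N)) =
      (H1.mapChainQuot (inclYX N) (rhoPoints N) (cusps N)) ∘ₗ (H1.toRel (rhoPoints N)) :=
    LinearMap.ext fun y => (H1.mapChainQuot_toRel _ _ _ y).symm
  have h := congrArg (fun l => LinearMap.baseChange ℂ l c) hcomp
  simpa only [LinearMap.baseChange_comp, LinearMap.comp_apply] using h

/-- Reversing the arc contributes a sign, so the minus part of the cycle carries the plus part of
the coefficients, after reindexing by `x ↦ xᶜ`. -/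
theorem gammaFormMinus_eq {g : E N → SL(2, ℤ)} (hg : IsLift g)
    (f : CuspForm (CongruenceSubgroup.Gamma1 N) 2) :
    gammaFormMinus g f = rhoCycle g (xiFormPlus g f) := by
  have hconj : ∀ x : E N, rhoSymbol N (twist (g x)) = rhoSymbol N (g x.conj) := fun x =>
    (leftInvariant_rhoSymbol.lift_conj hg x).symm
  have h : (H1.map (conjY N) (conjY_mapsTo N)).baseChange ℂ (gammaForm g f) =
      -∑ x : E N, xiForm g f x.conj ⊗ₜ[ℤ] rhoSymbol N (g x) := by
    rw [gammaForm, map_sum, ← E.sum_conj]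
    simp only [LinearMap.baseChange_tmul, conj_rhoSymbol, hconj, E.conj_conj,
      TensorProduct.tmul_neg, Finset.sum_neg_distrib]
  rw [gammaFormMinus, h, sub_neg_eq_add, gammaForm, ← Finset.sum_add_distrib, Finset.smul_sum,
    rhoCycle]
  refine Finset.sum_congr rfl fun x _ => ?_
  rw [← TensorProduct.add_tmul, TensorProduct.smul_tmul', smul_eq_mul, xiFormPlus]

end Cycles

end ModSym

theorem mainTheorem4 (N : ℕ) [NeZero N] (f : CuspForm (CongruenceSubgroup.Gamma1 N) 2)
    (g : ModSym.E N → SL(2, ℤ)) (hg : ModSym.IsLift g) :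
    (ModSym.IsClosedCycle (ModSym.gammaForm g f) ∧
      ∃ δ : ℂ ⊗[ℤ] ModSym.H1 (ModSym.X1 N) ∅,
        ModSym.IsImageInX (ModSym.gammaForm g f) δ ∧
        (ModSym.H1.toRel (ModSym.cusps N)).baseChange ℂ δ =
          ModSym.symbolSum g (ModSym.xiForm g f)) ∧
    (ModSym.IsClosedCycle (ModSym.gammaFormMinus g f) ∧
      ∃ δ : ℂ ⊗[ℤ] ModSym.H1 (ModSym.X1 N) ∅,
        ModSym.IsImageInX (ModSym.gammaFormMinus g f) δ ∧
        (ModSym.H1.toRel (ModSym.cusps N)).baseChange ℂ δ =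
          ModSym.symbolSum g (ModSym.xiFormPlus g f)) := by
  rw [ModSym.gammaFormMinus_eq hg]
  exact ⟨(ModSym.isManin_xiForm hg f).exists_isImageInX hg,
    (ModSym.isManin_xiFormPlus hg f).exists_isImageInX hg⟩
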